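/- A chord diagram of size $n$ is a perfect pairing of the $2n$ linearly ordered points $1,\dots,2n$; two of its chords $\{a,b\}$ and $\{c,d\}$ cross if $a<c<b<d$ (up to exchanging the chords and the names of their endpoints). Let $T_{n,m}$ be the number of chord diagrams of size $n$ with exactly $m$ crossings (so $T_{0,0}=1$), let $T(x,y)=\sum_{n,m\ge 0}T_{n,m}x^m y^n$ as a formal power series, and let $C_n=\frac1{n+1}\binom{2n}{n}$ be the $n$-th Catalan number. For $|x|<1$ put $$f(x)=\sum_{j\ge 0}(-1)^j x^{\binom{j+1}{2}}.$$ Let $m=m(n)$ be a sequence of non-negative integers with $m(n)=O(n)$ as $n\to\infty$, and set $q=q(n)=\frac{m}{m+n}$. Then, as $n\to\infty$, $$T_{n,m}\sim\binom{n+m-1}{n-1}\,C_n\prod_{j\ge 1}(1-q^j)^3,$$ and, for every fixed integer $\ell\ge 1$, $$[x^m y^n]\,T(x,y)^{\ell}\sim \ell\,\bigl(2f(q)\bigr)^{\ell-1}\,T_{n,m}.$$ -/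

import Mathlib

open Filter Asymptotics

/-- A (linearized) chord diagram of size `n`: a perfect pairing of `2 * n` linearly ordered points,
given by the fixed-point-free involution exchanging the two endpoints of each chord. -/
abbrev ChordDiagram (n : ℕ) : Type :=
  {σ : Equiv.Perm (Fin (2 * n)) // (∀ i, σ (σ i) = i) ∧ ∀ i, σ i ≠ i}

/-- The number of crossings, i.e. of unordered pairs of chords `{a, b}`, `{c, d}` with
`a < c < b < d`. Such a pair of chords is recorded once, by the left endpoints `(a, c)`. -/
def ChordDiagram.crossings {n : ℕ} (D : ChordDiagram n) : ℕ :=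
  (Finset.univ.filter fun p : Fin (2 * n) × Fin (2 * n) =>
    p.1 < p.2 ∧ p.2 < D.1 p.1 ∧ D.1 p.1 < D.1 p.2).card

/-- `T_{n,m}`: the number of chord diagrams of size `n` with exactly `m` crossings. -/
noncomputable def chordCount (n m : ℕ) : ℕ :=
  Nat.card {D : ChordDiagram n // D.crossings = m}

/-- The formal generating function `T(x, y) = ∑_n (∑_m T_{n,m} x^m) y^n`. The outer variable is `y`,
the inner variable is `x`. -/
noncomputable def chordSeries : PowerSeries (PowerSeries ℝ) :=
  PowerSeries.mk fun n => PowerSeries.mk fun m => (chordCount n m : ℝ)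

/-- The coefficient `[x^m y^n] T(x, y)^ℓ`. -/
noncomputable def chordSeriesPowCoeff (l n m : ℕ) : ℝ :=
  PowerSeries.coeff m (PowerSeries.coeff n (chordSeries ^ l))

/-- `q = m / (m + n)`. -/
noncomputable def crossingRatio (n m : ℕ) : ℝ := (m : ℝ) / ((m : ℝ) + (n : ℝ))

/-- `f(x) = ∑_{j ≥ 0} (-1)^j x^{j(j+1)/2}`, used for `|x| < 1`, where the series converges
absolutely. -/
noncomputable def altTriangularSeries (x : ℝ) : ℝ :=
  ∑' j : ℕ, (-1 : ℝ) ^ j * x ^ ((j + 1).choose 2)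

/-- `∏_{j ≥ 1} (1 - x^j)^3`, used for `|x| < 1`, where the product converges absolutely. -/
noncomputable def eulerProductCubed (x : ℝ) : ℝ :=
  ∏' j : ℕ, (1 - x ^ (j + 1)) ^ 3

/-! Replacing `y` by `(1 - x) y` turns `T` into an explicit series. By the Touchard–Riordan formula
(`touchardRiordan`), `B(x, y) = T(x, (1 - x) y)` has `y ^ n` coefficient `∑ k, (-1) ^ k b(n, k) x ^
(k (k + 1) / 2)`, where `b(n, k)` counts nonnegative paths of `2 n` steps ending at height `2 k`. So
`[y ^ n] T ^ l = (1 - x) ^ (-n) [y ^ n] B ^ l`, and extracting `x ^ m` gives `binom(n + m - 1, n -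
1)` times a sum over `t` of `[x ^ t y ^ n] B ^ l` weighted by a ratio of binomials
(`chordSeriesPowCoeff_eq`). When `m = O(n)`, that ratio differs from `q ^ t` by `o(1)` for each `t`
and is at most `r ^ t` for a fixed `r < 1`.

For fixed `k`, `b(n, k) / C_n` tends to `2 k + 1`, and `b(n, k) / 4 ^ n` sums over `n` to `2`. Since
`C_n / 4 ^ n` is subexponential, a convolution of such sequences is dominated by its two ends
(`CatalanRegular.convolution`). Limits and sums therefore multiply by the product rule, and `[y ^ n]
B ^ l / C_n` tends coefficientwise to `l α S ^ (l - 1)` with `α = ∑ (-1) ^ k (2 k + 1) x ^ (k (k +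
1) / 2)` and `S = 2 f`. Jacobi's identity (`hasSum_jacobi`) identifies `α` with the cubed Euler
product.

Dominated convergence (`tendsto_tsum_coeffRatio_sub`) makes the weighted sum, divided by `C_n`,
differ from `l α(q) S(q) ^ (l - 1)` by `o(1)`. As `q` stays at most `r`, this value is bounded below
by a positive constant, so the difference estimate is an asymptotic equivalence. -/

/-- The Gaussian binomial coefficient `[h + k, k]` at `q`. -/
def gaussBinom {R : Type*} [CommRing R] (q : R) : ℕ → ℕ → R
  | 0, _ => 1
  | _ + 1, 0 => 1
  | h + 1, k + 1 => gaussBinom q (h + 1) k + q ^ (k + 1) * gaussBinom q h (k + 1)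

/-! ### Gaussian binomials and a finite Jacobi identity -/

section GaussBinom

variable {R : Type*} [CommRing R] (q : R)

@[simp] theorem gaussBinom_zero_left (k : ℕ) : gaussBinom q 0 k = 1 := by
  simp [gaussBinom]

@[simp] theorem gaussBinom_zero_right (h : ℕ) : gaussBinom q h 0 = 1 := by
  cases h <;> simp [gaussBinom]

theorem gaussBinom_succ_succ (h k : ℕ) :
    gaussBinom q (h + 1) (k + 1) =
      gaussBinom q (h + 1) k + q ^ (k + 1) * gaussBinom q h (k + 1) := by
  rw [gaussBinom]

/-- The two absorption rules are proved together because the inductive step for either one uses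
both. Their difference then yields the mirror Pascal rule, without dividing by any `1 - q ^ j`. -/
theorem gaussBinom_absorb (h k : ℕ) :
    (1 - q ^ (k + 1)) * gaussBinom q h (k + 1) = (1 - q ^ (h + k + 1)) * gaussBinom q h k ∧
    (1 - q ^ (h + 1)) * gaussBinom q (h + 1) k = (1 - q ^ (h + k + 1)) * gaussBinom q h k := by
  have stepA : ∀ h k : ℕ,
      ((1 - q ^ (k + 1)) * gaussBinom q h (k + 1) = (1 - q ^ (h + k + 1)) * gaussBinom q h k ∧
       (1 - q ^ (h + 1)) * gaussBinom q (h + 1) k = (1 - q ^ (h + k + 1)) * gaussBinom q h k) →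
      (1 - q ^ (k + 1)) * gaussBinom q (h + 1) (k + 1) =
        (1 - q ^ (h + 1 + k + 1)) * gaussBinom q (h + 1) k := by
    rintro h k ⟨hA, hB⟩
    rw [gaussBinom_succ_succ]
    linear_combination q ^ (k + 1) * hA - q ^ (k + 1) * hB
  have stepB : ∀ h k : ℕ,
      ((1 - q ^ (k + 1)) * gaussBinom q h (k + 1) = (1 - q ^ (h + k + 1)) * gaussBinom q h k ∧
       (1 - q ^ (h + 1)) * gaussBinom q (h + 1) k = (1 - q ^ (h + k + 1)) * gaussBinom q h k) →
      (1 - q ^ (h + 1)) * gaussBinom q (h + 1) (k + 1) =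
        (1 - q ^ (h + (k + 1) + 1)) * gaussBinom q h (k + 1) := by
    rintro h k ⟨hA, hB⟩
    rw [gaussBinom_succ_succ]
    linear_combination hB - hA
  induction h generalizing k with
  | zero =>
    induction k with
    | zero => simp
    | succ k ih => exact ⟨by simp, stepB 0 k ih⟩
  | succ h ih =>
    induction k with
    | zero => exact ⟨stepA h 0 (ih 0), by simp⟩
    | succ k ih' => exact ⟨stepA h (k + 1) (ih (k + 1)), stepB (h + 1) k ih'⟩

theorem gaussBinom_succ_succ' (h k : ℕ) :
    gaussBinom q (h + 1) (k + 1) =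
      q ^ (h + 1) * gaussBinom q (h + 1) k + gaussBinom q h (k + 1) := by
  have h1 := (gaussBinom_absorb q h k).1
  have h2 := (gaussBinom_absorb q h k).2
  rw [gaussBinom_succ_succ]
  linear_combination h2 - h1

theorem gaussBinom_mul_prod (h k : ℕ) :
    gaussBinom q h k * ((∏ j ∈ Finset.range h, (1 - q ^ (j + 1))) *
      ∏ j ∈ Finset.range k, (1 - q ^ (j + 1))) =
      ∏ j ∈ Finset.range (h + k), (1 - q ^ (j + 1)) := by
  induction k with
  | zero => simp
  | succ k ih =>
    rw [← add_assoc, Finset.prod_range_succ _ (h + k), ← ih, Finset.prod_range_succ _ k]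
    linear_combination ((∏ j ∈ Finset.range h, (1 - q ^ (j + 1))) *
      ∏ j ∈ Finset.range k, (1 - q ^ (j + 1))) * (gaussBinom_absorb q h k).1

/-- The Gaussian binomial coefficient `[2n + 1, n - k]`. -/
def oddGaussBinom (n k : ℕ) : R := if k ≤ n then gaussBinom q (n - k) (n + 1 + k) else 0

theorem oddGaussBinom_of_lt {n k : ℕ} (h : n < k) : oddGaussBinom q n k = 0 := by
  simp [oddGaussBinom, Nat.not_le.2 h]

theorem oddGaussBinom_add (i k : ℕ) :
    oddGaussBinom q (i + k) k = gaussBinom q i (i + k + 1 + k) := by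
  simp [oddGaussBinom]

theorem gaussBinom_comm (h k : ℕ) : gaussBinom q h k = gaussBinom q k h := by
  induction h generalizing k with
  | zero => simp
  | succ h ih =>
    induction k with
    | zero => simp
    | succ k ih' =>
      rw [gaussBinom_succ_succ, gaussBinom_succ_succ', ih', ih (k + 1)]
      ring

/-- This is the boundary case of the three-term recurrence below: the neighbour of index `-1` equals
that of index `0`, by the symmetry `[2n + 1, n + 1] = [2n + 1, n]`. -/
theorem oddGaussBinom_succ_zero (n : ℕ) :
    oddGaussBinom q (n + 1) 0 = q ^ (n + 1) * oddGaussBinom q n 0 +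
      (1 + q ^ (2 * n + 2)) * oddGaussBinom q n 0 + q ^ (n + 2) * oddGaussBinom q n 1 := by
  have e1 : oddGaussBinom q (n + 1) 0 = gaussBinom q (n + 1) (n + 1 + 1) :=
    oddGaussBinom_add q (n + 1) 0
  have e2 : oddGaussBinom q n 0 = gaussBinom q n (n + 1) := oddGaussBinom_add q n 0
  rw [e1, e2, gaussBinom_succ_succ, gaussBinom_succ_succ' q n n, gaussBinom_comm q (n + 1) n]
  cases n with
  | zero => simp [oddGaussBinom]; ring
  | succ n =>
    have e3 : oddGaussBinom q (n + 1) 1 = gaussBinom q n (n + 1 + 1 + 1) :=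
      oddGaussBinom_add q n 1
    rw [e3, gaussBinom_succ_succ' q n (n + 1 + 1)]
    ring

/-- Two rounds of Pascal, mixing both forms, raise the top index by two. The resulting three-term
recurrence drives the induction for the finite Jacobi identity. -/
theorem oddGaussBinom_succ_succ (i k : ℕ) :
    oddGaussBinom q (i + k + 1) (k + 1) = q ^ i * oddGaussBinom q (i + k) k +
      (1 + q ^ (2 * (i + k) + 2)) * oddGaussBinom q (i + k) (k + 1) +
      q ^ (i + 2 * k + 3) * oddGaussBinom q (i + k) (k + 2) := by
  have e1 : oddGaussBinom q (i + k + 1) (k + 1) = gaussBinom q i (i + k + 1 + k + 1 + 1) := by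
    rw [add_assoc, oddGaussBinom_add]; congr 1; ring
  rw [e1, oddGaussBinom_add]
  rcases i with _ | _ | i
  · simp [oddGaussBinom_of_lt]
  · have e2 : oddGaussBinom q (0 + 1 + k) (k + 1) = 1 := by
      rw [show 0 + 1 + k = 0 + (k + 1) by ring, oddGaussBinom_add]; simp
    rw [e2, oddGaussBinom_of_lt q (by omega : 0 + 1 + k < k + 2), gaussBinom_succ_succ,
      gaussBinom_succ_succ']
    simp only [gaussBinom_zero_left]
    ring
  · have e2 : oddGaussBinom q (i + 1 + 1 + k) (k + 1) =
        gaussBinom q (i + 1) (i + 1 + 1 + k + 1 + k + 1) := by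
      rw [show i + 1 + 1 + k = (i + 1) + (k + 1) by ring, oddGaussBinom_add]; congr 1
    have e3 : oddGaussBinom q (i + 1 + 1 + k) (k + 2) =
        gaussBinom q i (i + 1 + 1 + k + 1 + k + 1 + 1) := by
      rw [show i + 1 + 1 + k = i + (k + 2) by ring, oddGaussBinom_add]; congr 1
    rw [e2, e3, gaussBinom_succ_succ q (i + 1) (i + 1 + 1 + k + 1 + k + 1),
      gaussBinom_succ_succ' q (i + 1) (i + 1 + 1 + k + 1 + k),
      gaussBinom_succ_succ' q i (i + 1 + 1 + k + 1 + k + 1)]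
    ring

theorem choose_succ_two (k : ℕ) : (k + 2).choose 2 = (k + 1).choose 2 + (k + 1) := by
  rw [Nat.choose_succ_succ' (k + 1) 1]; simp; ring

/-- A finite form of Jacobi's identity for the cube of the Euler product. -/
theorem sum_oddGaussBinom (n : ℕ) :
    ∑ k ∈ Finset.range (n + 1),
      (-1) ^ k * (2 * k + 1) * q ^ (k + 1).choose 2 * oddGaussBinom q n k =
      ∏ j ∈ Finset.range n, (1 - q ^ (j + 1)) ^ 2 := by
  induction n with
  | zero => simp [oddGaussBinom]
  | succ n ih =>
    rw [Finset.prod_range_succ, ← ih, Finset.sum_range_succ', oddGaussBinom_succ_zero]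
    set w : ℕ → R := fun k => (-1) ^ k * (2 * k + 1) * q ^ (k + 1).choose 2 with hw
    have hstep : ∀ k ∈ Finset.range (n + 1), (-1) ^ (k + 1) * (2 * ((k + 1 : ℕ) : R) + 1) *
        q ^ (k + 1 + 1).choose 2 * oddGaussBinom q (n + 1) (k + 1) =
        (-1) ^ (k + 1) * (2 * k + 3) * q ^ ((k + 1).choose 2 + (n + 1)) * oddGaussBinom q n k +
        (1 + q ^ (2 * n + 2)) * (w (k + 1) * oddGaussBinom q n (k + 1)) +
        (-1) ^ (k + 1) * (2 * k + 3) * q ^ ((k + 3).choose 2 + (n + 1)) *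
          oddGaussBinom q n (k + 2) := by
      intro k hk
      obtain ⟨i, rfl⟩ := Nat.exists_eq_add_of_le' (Nat.lt_succ_iff.1 (Finset.mem_range.1 hk))
      rw [oddGaussBinom_succ_succ, hw]
      simp only [choose_succ_two]
      push_cast
      ring
    rw [Finset.sum_congr rfl hstep, Finset.sum_add_distrib, Finset.sum_add_distrib,
      ← Finset.mul_sum]
    have h1 : ∑ k ∈ Finset.range (n + 1), w (k + 1) * oddGaussBinom q n (k + 1) =
        ∑ k ∈ Finset.range (n + 1), w k * oddGaussBinom q n k - oddGaussBinom q n 0 := by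
      rw [Finset.sum_range_succ, oddGaussBinom_of_lt q (Nat.lt_succ_self n),
        Finset.sum_range_succ' _ n]
      simp [hw]
    -- The two boundary terms created by this shift cancel the outer terms of
    -- `oddGaussBinom_succ_zero`.
    have h2 : ∑ k ∈ Finset.range (n + 1), (-1) ^ (k + 1) * (2 * (k : R) + 3) *
          q ^ ((k + 3).choose 2 + (n + 1)) * oddGaussBinom q n (k + 2) =
        ∑ k ∈ Finset.range (n + 1), (-1) ^ (k + 1) * (2 * (k : R) - 1) *
          q ^ ((k + 1).choose 2 + (n + 1)) * oddGaussBinom q n k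
          - q ^ (n + 1) * oddGaussBinom q n 0 - q ^ (n + 2) * oddGaussBinom q n 1 := by
      have h3 : ∑ k ∈ Finset.range (n + 3), (-1) ^ (k + 1) * (2 * (k : R) - 1) *
          q ^ ((k + 1).choose 2 + (n + 1)) * oddGaussBinom q n k =
          ∑ k ∈ Finset.range (n + 1), (-1) ^ (k + 1) * (2 * (k : R) - 1) *
          q ^ ((k + 1).choose 2 + (n + 1)) * oddGaussBinom q n k := by
        rw [Finset.sum_range_succ, Finset.sum_range_succ,
          oddGaussBinom_of_lt q (by omega : n < n + 1),
          oddGaussBinom_of_lt q (by omega : n < n + 2)]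
        simp
      rw [← h3, Finset.sum_range_succ' _ (n + 2), Finset.sum_range_succ' _ (n + 1)]
      simp
      ring_nf
      exact Finset.sum_congr rfl fun x _ => by ring
    rw [h1, h2, Finset.sum_mul]
    -- The two neighbours contribute `-(2k + 3) - (2k - 1) = -2 (2k + 1)` at `q ^ (n + 1)`, which
    -- completes the square with `1 + q ^ (2n + 2)`.
    have h4 : ∑ k ∈ Finset.range (n + 1), w k * oddGaussBinom q n k * (1 - q ^ (n + 1)) ^ 2 =
        ∑ k ∈ Finset.range (n + 1), (-1) ^ (k + 1) * (2 * (k : R) + 3) *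
          q ^ ((k + 1).choose 2 + (n + 1)) * oddGaussBinom q n k +
        (1 + q ^ (2 * n + 2)) * ∑ k ∈ Finset.range (n + 1), w k * oddGaussBinom q n k +
        ∑ k ∈ Finset.range (n + 1), (-1) ^ (k + 1) * (2 * (k : R) - 1) *
          q ^ ((k + 1).choose 2 + (n + 1)) * oddGaussBinom q n k := by
      rw [Finset.mul_sum, ← Finset.sum_add_distrib, ← Finset.sum_add_distrib]
      refine Finset.sum_congr rfl fun k _ => ?_
      rw [hw]
      ring
    rw [h4]
    simp
    ring

end GaussBinom

/-! ### Ballot and Catalan numbers, their ratios and sums -/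

/-- The ballot numbers: the number of paths of `N` steps `±1` from `0` to `j` that stay `≥ 0`. -/
def ballot : ℕ → ℕ → ℕ
  | 0, 0 => 1
  | 0, _ + 1 => 0
  | N + 1, 0 => ballot N 1
  | N + 1, j + 1 => ballot N j + ballot N (j + 2)

theorem ballot_eq_zero {N j : ℕ} (h : N < j) : ballot N j = 0 := by
  induction N generalizing j with
  | zero => obtain ⟨j, rfl⟩ := Nat.exists_eq_succ_of_ne_zero h.ne'; rfl
  | succ N ih =>
    obtain ⟨j, rfl⟩ := Nat.exists_eq_succ_of_ne_zero (by omega : j ≠ 0)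
    rw [Nat.succ_eq_add_one, ballot, ih (by omega), ih (by omega)]

/-- The reflection principle with `i` down-steps, in additive form to avoid truncated subtraction.
-/
theorem ballot_add_choose {N j i : ℕ} (h : N = j + 2 * i) :
    ballot N j + N.choose (i + j + 1) = N.choose i := by
  induction N generalizing j i with
  | zero =>
    obtain ⟨rfl, rfl⟩ : j = 0 ∧ i = 0 := by omega
    simp [ballot]
  | succ N ih =>
    rcases j with _ | j
    · obtain ⟨i, rfl⟩ := Nat.exists_eq_succ_of_ne_zero (by omega : i ≠ 0)
      have h1 := ih (j := 1) (i := i) (by omega)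
      rw [ballot]
      simp only [Nat.succ_eq_add_one, add_zero, Nat.choose_succ_succ'] at *
      have h2 : N.choose (i + 1) = N.choose (i + 1) := rfl
      omega
    · have h1 := ih (j := j) (i := i) (by omega)
      rcases i with _ | i
      · rw [ballot, ballot_eq_zero (by omega : N < j + 2)]
        rw [Nat.choose_eq_zero_of_lt (by omega)] at h1 ⊢
        simpa using h1
      · have h2 := ih (j := j + 2) (i := i) (by omega)
        rw [ballot, Nat.choose_succ_succ' N i, show i + 1 + (j + 1) + 1 = (i + 1 + j + 1) + 1 by ring,
          Nat.choose_succ_succ']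
        rw [show i + (j + 2) + 1 = i + 1 + j + 1 + 1 by ring] at h2
        omega

theorem ballot_mul {N j i : ℕ} (h : N = j + 2 * i) :
    (i + j + 1) * ballot N j = (j + 1) * N.choose i := by
  have h1 := ballot_add_choose h
  have h2 : N.choose (i + j + 1) * (i + j + 1) = N.choose i * i := by
    have h3 := Nat.choose_succ_right_eq N (i + j)
    have h4 : N.choose (i + j) = N.choose i := by
      rw [← Nat.choose_symm_of_eq_add (by omega : N = i + j + i)]
    rw [h3, h4]
    congr 1
    omega
  have : (i + j + 1) * ballot N j + N.choose (i + j + 1) * (i + j + 1) =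
      (j + 1) * N.choose i + N.choose i * i := by
    rw [← h1]; rw [← h1] at h2; nlinarith
  omega

/-- Ballot numbers of even length. -/
def evenBallot (n k : ℕ) : ℕ := ballot (2 * n) (2 * k)

theorem evenBallot_eq_zero {n k : ℕ} (h : n < k) : evenBallot n k = 0 :=
  ballot_eq_zero (by omega)

theorem evenBallot_zero_right (n : ℕ) : evenBallot n 0 = catalan n := by
  have h := ballot_mul (N := 2 * n) (j := 0) (i := n) (by omega)
  have h2 := succ_mul_catalan_eq_centralBinom n
  rw [Nat.centralBinom_eq_two_mul_choose] at h2
  have : (n + 1) * evenBallot n 0 = (n + 1) * catalan n := by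
    rw [h2]; simpa [evenBallot] using h
  exact Nat.eq_of_mul_eq_mul_left (Nat.succ_pos n) this

theorem evenBallot_succ_zero (n : ℕ) :
    evenBallot (n + 1) 0 = evenBallot n 0 + evenBallot n 1 := by
  simp only [evenBallot, mul_add, mul_one, mul_zero]
  rw [show 2 * n + 2 = (2 * n + 1) + 1 by ring, ballot, ballot]

theorem evenBallot_succ_succ (n k : ℕ) :
    evenBallot (n + 1) (k + 1) =
      evenBallot n k + 2 * evenBallot n (k + 1) + evenBallot n (k + 2) := by
  simp only [evenBallot, mul_add, mul_one]
  rw [show 2 * n + 2 = (2 * n + 1) + 1 by ring, ballot, ballot, ballot]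
  ring_nf

theorem evenBallot_le (n k : ℕ) : evenBallot n k ≤ (2 * k + 1) * catalan n := by
  rcases lt_or_ge n k with h | h
  · rw [evenBallot_eq_zero h]; exact Nat.zero_le _
  obtain ⟨i, rfl⟩ := Nat.exists_eq_add_of_le' h
  have h1 := ballot_mul (N := 2 * (i + k)) (j := 2 * k) (i := i) (by omega)
  have h2 := succ_mul_catalan_eq_centralBinom (i + k)
  have h3 := Nat.choose_le_centralBinom i (i + k)
  rw [← h2] at h3
  refine Nat.le_of_mul_le_mul_left (c := i + k + 1) ?_ (by omega)
  calc (i + k + 1) * evenBallot (i + k) k ≤ (i + 2 * k + 1) * evenBallot (i + k) k :=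
        Nat.mul_le_mul_right _ (by omega)
    _ = (2 * k + 1) * (2 * (i + k)).choose i := h1
    _ ≤ (2 * k + 1) * ((i + k + 1) * catalan (i + k)) := Nat.mul_le_mul_left _ h3
    _ = _ := by ring

theorem catalan_pos (n : ℕ) : 0 < catalan n := by
  have h := succ_mul_catalan_eq_centralBinom n
  have h2 := Nat.centralBinom_pos n
  exact Nat.pos_of_ne_zero fun h0 => by simp [h0] at h; omega

/-- `catalan n / 4 ^ n`. -/
noncomputable def scaledCatalan (n : ℕ) : ℝ := catalan n / 4 ^ n

theorem scaledCatalan_pos (n : ℕ) : 0 < scaledCatalan n :=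
  div_pos (Nat.cast_pos.2 (catalan_pos n)) (by positivity)

theorem catalan_succ_ratio (n : ℕ) : (n + 2) * catalan (n + 1) = 2 * (2 * n + 1) * catalan n := by
  have h1 := succ_mul_catalan_eq_centralBinom n
  have h2 := succ_mul_catalan_eq_centralBinom (n + 1)
  have h3 := Nat.succ_mul_centralBinom_succ n
  refine Nat.eq_of_mul_eq_mul_left (Nat.succ_pos n) ?_
  rw [Nat.succ_eq_add_one]
  calc (n + 1) * ((n + 2) * catalan (n + 1)) = (n + 1) * ((n + 1 + 1) * catalan (n + 1)) := by ring
    _ = 2 * (2 * n + 1) * ((n + 1) * catalan n) := by rw [h2, h3, h1]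
    _ = _ := by ring

theorem scaledCatalan_succ (n : ℕ) :
    scaledCatalan (n + 1) = (2 * n + 1) / (2 * (n + 2)) * scaledCatalan n := by
  have h : ((n : ℝ) + 2) * catalan (n + 1) = 2 * (2 * n + 1) * catalan n := by
    exact_mod_cast catalan_succ_ratio n
  have h2 : ((n : ℝ) + 2) ≠ 0 := by positivity
  rw [scaledCatalan, scaledCatalan, pow_succ]
  field_simp
  linear_combination h * 2

theorem scaledCatalan_zero : scaledCatalan 0 = 1 := by simp [scaledCatalan]

theorem scaledCatalan_succ_le (n : ℕ) : scaledCatalan (n + 1) ≤ scaledCatalan n := by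
  rw [scaledCatalan_succ]
  refine mul_le_of_le_one_left (scaledCatalan_pos n).le ?_
  rw [div_le_one (by positivity)]
  linarith

theorem tendsto_scaledCatalan_ratio :
    Tendsto (fun n => scaledCatalan (n + 1) / scaledCatalan n) atTop (nhds 1) := by
  have h : ∀ n : ℕ, scaledCatalan (n + 1) / scaledCatalan n = 1 - (3 / 2) / ((n : ℝ) + 2) := by
    intro n
    rw [scaledCatalan_succ, mul_div_assoc, div_self (scaledCatalan_pos n).ne']
    have h2 : ((n : ℝ) + 2) ≠ 0 := by positivity
    field_simp
    ring
  simp only [h]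
  have : Tendsto (fun n : ℕ => (3 / 2) / ((n : ℝ) + 2)) atTop (nhds 0) :=
    tendsto_const_nhds.div_atTop (tendsto_atTop_add_const_right _ _ tendsto_natCast_atTop_atTop)
  simpa using tendsto_const_nhds.sub this

/-- Makes the series of scaled Catalan numbers telescope. -/
theorem scaledCatalan_eq_sub (n : ℕ) : scaledCatalan n =
    2 * ((n + 1) * scaledCatalan n - (n + 2) * scaledCatalan (n + 1)) := by
  have h2 : ((n : ℝ) + 2) ≠ 0 := by positivity
  rw [scaledCatalan_succ]
  field_simp
  ring

/-- The left side starts at `1` and is nonincreasing. It gives the decay `n ^ (-3/2)`, enough to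
kill the telescoping remainder. -/
theorem succ_sq_mul_scaledCatalan_le (n : ℕ) :
    ((n : ℝ) + 1) ^ 2 * scaledCatalan n ^ 2 * (n + 1) ≤ 1 := by
  induction n with
  | zero => simp [scaledCatalan_zero]
  | succ n ih =>
    refine le_trans ?_ ih
    have h2 : ((n : ℝ) + 2) ≠ 0 := by positivity
    have e : (((n + 1 : ℕ) : ℝ) + 1) ^ 2 * scaledCatalan (n + 1) ^ 2 * ((n + 1 : ℕ) + 1) =
        ((2 * n + 1) ^ 2 * (n + 2) / 4) * scaledCatalan n ^ 2 := by
      rw [scaledCatalan_succ]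
      push_cast
      field_simp
      ring
    rw [e, mul_right_comm]
    refine mul_le_mul_of_nonneg_right ?_ (sq_nonneg _)
    have hn : (0 : ℝ) ≤ n := Nat.cast_nonneg n
    nlinarith [pow_nonneg hn 2, pow_nonneg hn 3]

theorem tendsto_succ_mul_scaledCatalan :
    Tendsto (fun n : ℕ => ((n : ℝ) + 1) * scaledCatalan n) atTop (nhds 0) := by
  have h : Tendsto (fun n : ℕ => (((n : ℝ) + 1) * scaledCatalan n) ^ 2) atTop (nhds 0) := by
    refine squeeze_zero (fun n => sq_nonneg _) (fun n => ?_)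
      (tendsto_one_div_add_atTop_nhds_zero_nat (𝕜 := ℝ))
    rw [le_div_iff₀ (by positivity), mul_pow]
    exact succ_sq_mul_scaledCatalan_le n
  have h2 := h.sqrt
  simp only [Real.sqrt_zero] at h2
  refine h2.congr fun n => Real.sqrt_sq ?_
  have := scaledCatalan_pos n
  positivity

theorem hasSum_scaledCatalan : HasSum scaledCatalan 2 := by
  rw [hasSum_iff_tendsto_nat_of_nonneg fun n => (scaledCatalan_pos n).le]
  have h : ∀ n : ℕ, ∑ i ∈ Finset.range n, scaledCatalan i =
      2 - 2 * ((n + 1) * scaledCatalan n) := by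
    intro n
    induction n with
    | zero => simp [scaledCatalan_zero]
    | succ n ih =>
      rw [Finset.sum_range_succ, ih]
      have := scaledCatalan_eq_sub n
      push_cast
      linear_combination this
  simp only [h]
  simpa using (tendsto_const_nhds (x := (2 : ℝ))).sub
    (tendsto_succ_mul_scaledCatalan.const_mul 2)

/-- `evenBallot n k / 4 ^ n`. -/
noncomputable def scaledBallot (n k : ℕ) : ℝ := evenBallot n k / 4 ^ n

theorem scaledBallot_zero_right (n : ℕ) : scaledBallot n 0 = scaledCatalan n := by
  rw [scaledBallot, scaledCatalan, evenBallot_zero_right]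

theorem scaledBallot_nonneg (n k : ℕ) : 0 ≤ scaledBallot n k := by
  unfold scaledBallot; positivity

theorem scaledBallot_le (n k : ℕ) : scaledBallot n k ≤ (2 * k + 1) * scaledCatalan n := by
  rw [scaledBallot, scaledCatalan, ← mul_div_assoc]
  gcongr
  exact_mod_cast evenBallot_le n k

theorem scaledBallot_one (n : ℕ) :
    scaledBallot n 1 = 4 * scaledBallot (n + 1) 0 - scaledBallot n 0 := by
  have h : (evenBallot (n + 1) 0 : ℝ) = evenBallot n 0 + evenBallot n 1 := by
    exact_mod_cast evenBallot_succ_zero n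
  rw [scaledBallot, scaledBallot, scaledBallot, h, pow_succ]
  field_simp
  ring

theorem scaledBallot_add_two (n k : ℕ) : scaledBallot n (k + 2) =
    4 * scaledBallot (n + 1) (k + 1) - 2 * scaledBallot n (k + 1) - scaledBallot n k := by
  have h : (evenBallot (n + 1) (k + 1) : ℝ) =
      evenBallot n k + 2 * evenBallot n (k + 1) + evenBallot n (k + 2) := by
    exact_mod_cast evenBallot_succ_succ n k
  simp only [scaledBallot]
  rw [h, pow_succ]
  field_simp
  ring

theorem tendsto_shift_div_scaledCatalan {u : ℕ → ℝ} {a : ℝ}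
    (hu : Tendsto (fun n => u n / scaledCatalan n) atTop (nhds a)) :
    Tendsto (fun n => u (n + 1) / scaledCatalan n) atTop (nhds a) := by
  have h := ((tendsto_add_atTop_iff_nat 1).2 hu).mul tendsto_scaledCatalan_ratio
  rw [mul_one] at h
  refine h.congr fun n => ?_
  have h1 := (scaledCatalan_pos n).ne'
  have h2 := (scaledCatalan_pos (n + 1)).ne'
  field_simp

/-- Since shifting `n` does not affect limits relative to `scaledCatalan`, the limits satisfy `L (k
+ 2) = 2 L (k + 1) - L k` with `L 0 = 1` and `L 1 = 3`, hence are linear in `k`. -/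
theorem tendsto_scaledBallot (k : ℕ) :
    Tendsto (fun n => scaledBallot n k / scaledCatalan n) atTop (nhds (2 * k + 1)) := by
  induction k using Nat.strong_induction_on with
  | _ k ih =>
    have h0 : Tendsto (fun n => scaledBallot n 0 / scaledCatalan n) atTop (nhds 1) := by
      simp only [scaledBallot_zero_right, div_self (scaledCatalan_pos _).ne']
      exact tendsto_const_nhds
    rcases k with _ | _ | k
    · simpa using h0
    · have h := ((tendsto_shift_div_scaledCatalan (u := fun n => scaledBallot n 0) h0).const_mul
        4).sub h0
      refine (h.congr fun n => ?_).trans (by norm_num)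
      rw [zero_add, scaledBallot_one]
      ring
    · have h1 := ih (k + 1) (by omega)
      have h2 := ((tendsto_shift_div_scaledCatalan (u := fun n => scaledBallot n (k + 1))
        h1).const_mul 4).sub ((h1.const_mul 2).add (ih k (by omega)))
      have e : 4 * (2 * ((k + 1 : ℕ) : ℝ) + 1) - (2 * (2 * ((k + 1 : ℕ) : ℝ) + 1) + (2 * k + 1)) =
          2 * ((k + 1 + 1 : ℕ) : ℝ) + 1 := by push_cast; ring
      rw [e] at h2
      refine h2.congr fun n => ?_
      rw [scaledBallot_add_two]
      ring

/-- The same recurrence acts on the sums, with the `n = 0` term as correction; that term is nonzero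
only at height `0`, and the constant `2` results. -/
theorem hasSum_scaledBallot (k : ℕ) : HasSum (fun n => scaledBallot n k) 2 := by
  induction k using Nat.strong_induction_on with
  | _ k ih =>
    have h0 : HasSum (fun n => scaledBallot n 0) 2 := by
      simpa only [scaledBallot_zero_right] using hasSum_scaledCatalan
    have shift : ∀ k, HasSum (fun n => scaledBallot n k) 2 →
        HasSum (fun n => scaledBallot (n + 1) k) (2 - scaledBallot 0 k) := fun k h => by
      simpa using (hasSum_nat_add_iff' 1).2 h
    rcases k with _ | _ | k
    · exact h0
    · have h := ((shift 0 h0).mul_left 4).sub h0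
      rw [scaledBallot_zero_right, scaledCatalan_zero] at h
      norm_num at h
      simpa only [zero_add, scaledBallot_one] using h
    · have h1 := ih (k + 1) (by omega)
      have h2 := (((shift (k + 1) h1).mul_left 4).sub (h1.mul_left 2)).sub (ih k (by omega))
      have e : scaledBallot 0 (k + 1) = 0 := by
        simp [scaledBallot, evenBallot_eq_zero]
      rw [e] at h2
      norm_num at h2
      simpa only [scaledBallot_add_two] using h2

/-! ### The Euler product and Jacobi's identity -/

section Euler

variable {q : ℝ}

/-- The Euler product `∏_{j ≥ 1} (1 - q ^ j)`. -/
noncomputable def eulerProduct (q : ℝ) : ℝ := ∏' j : ℕ, (1 - q ^ (j + 1))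

theorem summable_norm_neg_pow_succ (h0 : 0 ≤ q) (h1 : q < 1) :
    Summable fun j : ℕ => ‖-q ^ (j + 1)‖ := by
  simp only [norm_neg, norm_pow, Real.norm_of_nonneg h0]
  exact (summable_nat_add_iff 1).2 (summable_geometric_of_lt_one h0 h1)

theorem multipliable_one_sub_pow_succ (h0 : 0 ≤ q) (h1 : q < 1) :
    Multipliable fun j : ℕ => 1 - q ^ (j + 1) := by
  simpa only [← sub_eq_add_neg] using
    multipliable_one_add_of_summable (summable_norm_neg_pow_succ h0 h1)

theorem one_sub_pow_succ_pos (h0 : 0 ≤ q) (h1 : q < 1) (j : ℕ) : 0 < 1 - q ^ (j + 1) :=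
  sub_pos.2 (pow_lt_one₀ h0 h1 (Nat.succ_ne_zero j))

theorem tendsto_prod_eulerProduct (h0 : 0 ≤ q) (h1 : q < 1) :
    Tendsto (fun n => ∏ j ∈ Finset.range n, (1 - q ^ (j + 1))) atTop (nhds (eulerProduct q)) :=
  (multipliable_one_sub_pow_succ h0 h1).tendsto_prod_tprod_nat

theorem prod_one_sub_pow_pos (h0 : 0 ≤ q) (h1 : q < 1) (n : ℕ) :
    0 < ∏ j ∈ Finset.range n, (1 - q ^ (j + 1)) :=
  Finset.prod_pos fun j _ => one_sub_pow_succ_pos h0 h1 j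

theorem eulerProduct_pos (h0 : 0 ≤ q) (h1 : q < 1) : 0 < eulerProduct q := by
  have hne : eulerProduct q ≠ 0 := by
    have := tprod_one_add_ne_zero_of_summable (f := fun j : ℕ => -q ^ (j + 1))
      (fun j => by rw [← sub_eq_add_neg]; exact (one_sub_pow_succ_pos h0 h1 j).ne')
      (summable_norm_neg_pow_succ h0 h1)
    simpa only [← sub_eq_add_neg, eulerProduct] using this
  exact lt_of_le_of_ne (ge_of_tendsto' (tendsto_prod_eulerProduct h0 h1)
    fun n => (prod_one_sub_pow_pos h0 h1 n).le) hne.symm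

theorem prod_one_sub_pow_antitone (h0 : 0 ≤ q) (h1 : q < 1) :
    Antitone fun n => ∏ j ∈ Finset.range n, (1 - q ^ (j + 1)) := by
  refine antitone_nat_of_succ_le fun n => ?_
  rw [Finset.prod_range_succ]
  exact mul_le_of_le_one_right (prod_one_sub_pow_pos h0 h1 n).le
    (sub_le_self _ (pow_nonneg h0 _))

theorem eulerProduct_le_prod (h0 : 0 ≤ q) (h1 : q < 1) (n : ℕ) :
    eulerProduct q ≤ ∏ j ∈ Finset.range n, (1 - q ^ (j + 1)) :=
  (prod_one_sub_pow_antitone h0 h1).le_of_tendsto (tendsto_prod_eulerProduct h0 h1) n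

theorem eulerProduct_antitone {r : ℝ} (h0 : 0 ≤ q) (hqr : q ≤ r) (h1 : r < 1) :
    eulerProduct r ≤ eulerProduct q := by
  refine le_of_tendsto_of_tendsto' (tendsto_prod_eulerProduct (h0.trans hqr) h1)
    (tendsto_prod_eulerProduct h0 (hqr.trans_lt h1)) fun n => ?_
  refine Finset.prod_le_prod (fun j _ => (one_sub_pow_succ_pos (h0.trans hqr) h1 j).le)
    fun j _ => ?_
  gcongr

theorem eulerProductCubed_eq (h0 : 0 ≤ q) (h1 : q < 1) :
    eulerProductCubed q = eulerProduct q ^ 3 :=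
  (multipliable_one_sub_pow_succ h0 h1).tprod_pow 3

theorem oddGaussBinom_eq_div (h0 : 0 ≤ q) (h1 : q < 1) {n k : ℕ} (hk : k ≤ n) :
    oddGaussBinom q n k = (∏ j ∈ Finset.range (2 * n + 1), (1 - q ^ (j + 1))) /
      ((∏ j ∈ Finset.range (n - k), (1 - q ^ (j + 1))) *
        ∏ j ∈ Finset.range (n + 1 + k), (1 - q ^ (j + 1))) := by
  have h := gaussBinom_mul_prod q (n - k) (n + 1 + k)
  rw [show n - k + (n + 1 + k) = 2 * n + 1 by omega] at h
  rw [oddGaussBinom, if_pos hk, eq_div_iff, h]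
  exact (mul_pos (prod_one_sub_pow_pos h0 h1 _) (prod_one_sub_pow_pos h0 h1 _)).ne'

theorem tendsto_oddGaussBinom (h0 : 0 ≤ q) (h1 : q < 1) (k : ℕ) :
    Tendsto (fun n => oddGaussBinom q n k) atTop (nhds (1 / eulerProduct q)) := by
  have hP := tendsto_prod_eulerProduct h0 h1
  have hp := eulerProduct_pos h0 h1
  have t1 : Tendsto (fun n : ℕ => 2 * n + 1) atTop atTop :=
    tendsto_atTop_mono (fun n => by rw [id]; omega) tendsto_id
  have t2 : Tendsto (fun n : ℕ => n + 1 + k) atTop atTop :=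
    tendsto_atTop_mono (fun n => by rw [id]; omega) tendsto_id
  have h := (hP.comp t1).div ((hP.comp (tendsto_sub_atTop_nat k)).mul (hP.comp t2))
    (mul_pos hp hp).ne'
  rw [div_mul_cancel_left₀ hp.ne', ← one_div] at h
  refine h.congr' ?_
  filter_upwards [eventually_ge_atTop k] with n hn
  exact (oddGaussBinom_eq_div h0 h1 hn).symm

/-- Uniformity in both `n` and `k` supplies the dominating series for the passage to the limit in
the finite Jacobi identity. -/
theorem abs_oddGaussBinom_le (h0 : 0 ≤ q) (h1 : q < 1) (n k : ℕ) :
    |oddGaussBinom q n k| ≤ 1 / eulerProduct q ^ 2 := by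
  have hp := eulerProduct_pos h0 h1
  rcases lt_or_ge n k with h | h
  · rw [oddGaussBinom_of_lt q h, abs_zero]; positivity
  rw [oddGaussBinom_eq_div h0 h1 h, abs_of_nonneg (div_nonneg (prod_one_sub_pow_pos h0 h1 _).le
    (mul_pos (prod_one_sub_pow_pos h0 h1 _) (prod_one_sub_pow_pos h0 h1 _)).le), sq]
  refine div_le_div₀ zero_le_one ?_ (mul_pos hp hp) ?_
  · simpa using prod_one_sub_pow_antitone h0 h1 (Nat.zero_le (2 * n + 1))
  · exact mul_le_mul (eulerProduct_le_prod h0 h1 _) (eulerProduct_le_prod h0 h1 _) hp.le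
      (prod_one_sub_pow_pos h0 h1 _).le

theorem le_succ_choose_two (k : ℕ) : k ≤ (k + 1).choose 2 := by
  induction k with
  | zero => simp
  | succ k ih => rw [choose_succ_two]; omega

theorem pow_succ_choose_two_le (h0 : 0 ≤ q) (h1 : q < 1) (k : ℕ) :
    q ^ (k + 1).choose 2 ≤ q ^ k :=
  pow_le_pow_of_le_one h0 h1.le (le_succ_choose_two k)

theorem summable_linear_mul_pow (h0 : 0 ≤ q) (h1 : q < 1) :
    Summable fun k : ℕ => (2 * (k : ℝ) + 1) * q ^ k := by
  have hq : ‖q‖ < 1 := by rwa [Real.norm_of_nonneg h0]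
  have h := ((summable_pow_mul_geometric_of_norm_lt_one 1 hq).mul_left 2).add
    (summable_geometric_of_lt_one h0 h1)
  refine h.congr fun k => ?_
  ring

/-- Jacobi's identity for the cube of the Euler product. -/
theorem hasSum_jacobi (h0 : 0 ≤ q) (h1 : q < 1) :
    HasSum (fun k : ℕ => (-1) ^ k * (2 * (k : ℝ) + 1) * q ^ (k + 1).choose 2)
      (eulerProduct q ^ 3) := by
  have hp := eulerProduct_pos h0 h1
  have hb : ∀ k : ℕ, ‖(-1) ^ k * (2 * (k : ℝ) + 1) * q ^ (k + 1).choose 2‖ ≤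
      (2 * (k : ℝ) + 1) * q ^ k := fun k => by
    have h2 : (0 : ℝ) ≤ 2 * k + 1 := by positivity
    rw [norm_mul, norm_mul, norm_pow, norm_neg, norm_one, one_pow, one_mul,
      Real.norm_of_nonneg h2, Real.norm_of_nonneg (pow_nonneg h0 _)]
    exact mul_le_mul_of_nonneg_left (pow_succ_choose_two_le h0 h1 k) h2
  have hs : Summable fun k : ℕ => (-1) ^ k * (2 * (k : ℝ) + 1) * q ^ (k + 1).choose 2 :=
    Summable.of_norm_bounded (summable_linear_mul_pow h0 h1) hb
  have hlim : Tendsto (fun n => ∑' k : ℕ, (-1) ^ k * (2 * (k : ℝ) + 1) * q ^ (k + 1).choose 2 *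
      oddGaussBinom q n k) atTop
      (nhds (∑' k : ℕ, (-1) ^ k * (2 * (k : ℝ) + 1) * q ^ (k + 1).choose 2 *
        (1 / eulerProduct q))) := by
    refine tendsto_tsum_of_dominated_convergence
      (bound := fun k => (2 * (k : ℝ) + 1) * q ^ k * (1 / eulerProduct q ^ 2))
      ((summable_linear_mul_pow h0 h1).mul_right _)
      (fun k => (tendsto_oddGaussBinom h0 h1 k).const_mul _) ?_
    filter_upwards with n k
    rw [norm_mul]
    exact mul_le_mul (hb k) (abs_oddGaussBinom_le h0 h1 n k) (norm_nonneg _)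
      ((norm_nonneg _).trans (hb k))
  have hfin : ∀ n, ∑' k : ℕ, (-1) ^ k * (2 * (k : ℝ) + 1) * q ^ (k + 1).choose 2 *
      oddGaussBinom q n k = (∏ j ∈ Finset.range n, (1 - q ^ (j + 1))) ^ 2 := fun n => by
    rw [tsum_eq_sum (s := Finset.range (n + 1)), sum_oddGaussBinom, Finset.prod_pow]
    intro k hk
    rw [oddGaussBinom_of_lt q (by simpa using hk), mul_zero]
  simp only [hfin] at hlim
  -- In the limit the finite identity says that the Jacobi sum divided by the Euler product is the
  -- square of that product.
  have he := tendsto_nhds_unique hlim ((tendsto_prod_eulerProduct h0 h1).pow 2)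
  rw [tsum_mul_right, mul_one_div, div_eq_iff hp.ne'] at he
  rw [pow_succ, ← he]
  exact hs.hasSum

end Euler

/-! ### Partial chord diagrams scanned from left to right -/

section Involutions

open Equiv

/-- The points below `N` not yet matched by `σ`. -/
def openPoints (N : ℕ) (σ : Perm ℕ) : Finset ℕ := (Finset.range N).filter fun i => σ i = i

/-- Pairs of arcs `{a, σ a}`, `{c, σ c}` with `a < c < σ a` and the second arc ending after the
first, where unmatched points are considered as arcs that are still open. -/
def openCrossings (N : ℕ) (σ : Perm ℕ) : Finset (ℕ × ℕ) :=
  (Finset.range N ×ˢ Finset.range N).filter fun p =>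
    p.1 < p.2 ∧ p.2 < σ p.1 ∧ (σ p.1 < σ p.2 ∨ σ p.2 = p.2)

open Classical in
/-- The involutions of `ℕ` supported below `N`. -/
noncomputable def involutions : ℕ → Finset (Perm ℕ)
  | 0 => {1}
  | N + 1 => involutions N ∪
      ((involutions N).sigma fun σ => openPoints N σ).image fun p => p.1 * swap p.2 N

theorem mul_swap_apply_left (σ : Perm ℕ) (i N : ℕ) : (σ * swap i N) i = σ N := by simp

theorem mul_swap_apply_right (σ : Perm ℕ) (i N : ℕ) : (σ * swap i N) N = σ i := by simp

theorem mul_swap_apply_of_ne (σ : Perm ℕ) {i N x : ℕ} (h1 : x ≠ i) (h2 : x ≠ N) :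
    (σ * swap i N) x = σ x := by
  rw [Perm.mul_apply, swap_apply_of_ne_of_ne h1 h2]

theorem mul_swap_involutive {σ : Perm ℕ} (hσ : ∀ x, σ (σ x) = x) {i N : ℕ} (hi : σ i = i)
    (hN : σ N = N) (x : ℕ) : (σ * swap i N) ((σ * swap i N) x) = x := by
  by_cases h1 : x = i
  · rw [h1, mul_swap_apply_left, hN, mul_swap_apply_right, hi]
  by_cases h2 : x = N
  · rw [h2, mul_swap_apply_right, hi, mul_swap_apply_left, hN]
  have h3 : σ x ≠ i := fun h => h1 (by rw [← hσ x, h, hi])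
  have h4 : σ x ≠ N := fun h => h2 (by rw [← hσ x, h, hN])
  rw [mul_swap_apply_of_ne σ h1 h2, mul_swap_apply_of_ne σ h3 h4, hσ]

theorem mem_involutions {N : ℕ} {σ : Perm ℕ} :
    σ ∈ involutions N ↔ (∀ x, σ (σ x) = x) ∧ ∀ x, N ≤ x → σ x = x := by
  classical
  induction N generalizing σ with
  | zero =>
    rw [involutions, Finset.mem_singleton]
    constructor
    · rintro rfl; simp
    · rintro ⟨-, h⟩; ext x; exact h x (Nat.zero_le x)
  | succ N ih =>
    rw [involutions, Finset.mem_union, Finset.mem_image]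
    constructor
    · rintro (h | ⟨⟨τ, i⟩, h, rfl⟩)
      · exact ⟨(ih.1 h).1, fun x hx => (ih.1 h).2 x (by omega)⟩
      · rw [Finset.mem_sigma, openPoints, Finset.mem_filter, Finset.mem_range, ih] at h
        obtain ⟨⟨h1, h2⟩, h3, h4⟩ := h
        refine ⟨mul_swap_involutive h1 h4 (h2 N le_rfl), fun x hx => ?_⟩
        dsimp only at h3 ⊢
        rw [mul_swap_apply_of_ne τ (by omega) (by omega)]
        exact h2 x (by omega)
    · rintro ⟨h1, h2⟩
      by_cases hN : σ N = N
      · left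
        refine ih.2 ⟨h1, fun x hx => ?_⟩
        rcases hx.eq_or_lt with rfl | hx
        · exact hN
        · exact h2 x hx
      · right
        have hlt : σ N < N := by
          by_contra h
          have h3 := h2 (σ N) (by omega)
          rw [h1] at h3
          exact hN h3.symm
        refine ⟨⟨σ * swap (σ N) N, σ N⟩, ?_, by simp [mul_assoc]⟩
        rw [Finset.mem_sigma, openPoints, Finset.mem_filter, Finset.mem_range, ih]
        refine ⟨⟨fun x => ?_, fun x hx => ?_⟩, hlt, mul_swap_apply_left _ _ _⟩
        · by_cases hx1 : x = σ N
          · rw [hx1, mul_swap_apply_left, mul_swap_apply_left]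
          by_cases hx2 : x = N
          · rw [hx2, mul_swap_apply_right, h1, mul_swap_apply_right, h1]
          have h3 : σ x ≠ σ N := fun h => hx2 (σ.injective h)
          have h4 : σ x ≠ N := fun h => hx1 (by rw [← h, h1])
          rw [mul_swap_apply_of_ne σ hx1 hx2, mul_swap_apply_of_ne σ h3 h4, h1]
        · rcases hx.eq_or_lt with rfl | hx
          · rw [mul_swap_apply_right, h1]
          · rw [mul_swap_apply_of_ne σ (by omega) (by omega)]
            exact h2 x hx

theorem mem_openPoints {N : ℕ} {σ : Perm ℕ} {i : ℕ} : i ∈ openPoints N σ ↔ i < N ∧ σ i = i := by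
  simp [openPoints]

theorem mem_openCrossings {N : ℕ} {σ : Perm ℕ} {a c : ℕ} : (a, c) ∈ openCrossings N σ ↔
    (a < N ∧ c < N) ∧ a < c ∧ c < σ a ∧ (σ a < σ c ∨ σ c = c) := by
  simp [openCrossings]

theorem card_openPoints_succ {N : ℕ} {σ : Perm ℕ} (h : σ ∈ involutions N) :
    (openPoints (N + 1) σ).card = (openPoints N σ).card + 1 := by
  have : openPoints (N + 1) σ = insert N (openPoints N σ) := by
    ext x
    rw [Finset.mem_insert, mem_openPoints, mem_openPoints]
    have := (mem_involutions.1 h).2 N le_rfl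
    constructor
    · rintro ⟨h1, h2⟩
      rcases (Nat.lt_succ_iff.1 h1).eq_or_lt with h3 | h3
      · exact Or.inl h3
      · exact Or.inr ⟨h3, h2⟩
    · rintro (rfl | ⟨h1, h2⟩)
      · exact ⟨Nat.lt_succ_self _, this⟩
      · exact ⟨by omega, h2⟩
  rw [this, Finset.card_insert_of_notMem]
  simp [mem_openPoints]

theorem lt_of_mem_involutions {N : ℕ} {σ : Perm ℕ} (h : σ ∈ involutions N) {x : ℕ} (hx : x < N) :
    σ x < N := by
  by_contra h1
  have h2 := (mem_involutions.1 h).2 (σ x) (by omega)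
  rw [(mem_involutions.1 h).1] at h2
  omega

theorem openCrossings_succ {N : ℕ} {σ : Perm ℕ} (h : σ ∈ involutions N) :
    openCrossings (N + 1) σ = openCrossings N σ := by
  ext ⟨a, c⟩
  rw [mem_openCrossings, mem_openCrossings]
  have hN := (mem_involutions.1 h).2 N le_rfl
  constructor
  · rintro ⟨⟨h1, h2⟩, h3, h4, h5⟩
    have ha : a < N := by omega
    have := lt_of_mem_involutions h ha
    exact ⟨⟨ha, by omega⟩, h3, h4, h5⟩
  · rintro ⟨⟨h1, h2⟩, h3⟩
    exact ⟨⟨by omega, by omega⟩, h3⟩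

theorem card_openPoints_mul_swap {N i : ℕ} {σ : Perm ℕ} (h : σ ∈ involutions N)
    (hi : i ∈ openPoints N σ) :
    (openPoints (N + 1) (σ * swap i N)).card + 1 = (openPoints N σ).card := by
  have hN := (mem_involutions.1 h).2 N le_rfl
  have hi' := mem_openPoints.1 hi
  have : openPoints (N + 1) (σ * swap i N) = (openPoints N σ).erase i := by
    ext x
    rw [Finset.mem_erase, mem_openPoints, mem_openPoints]
    by_cases h1 : x = i
    · rw [h1, mul_swap_apply_left, hN]
      omega
    by_cases h2 : x = N
    · rw [h2, mul_swap_apply_right, hi'.2]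
      omega
    rw [mul_swap_apply_of_ne σ h1 h2]
    omega
  rw [this]
  exact Finset.card_erase_add_one hi

/-- The chord closed at `N` is bound to cross exactly those chords that opened after `i` and are
still open. Each crossing is counted when its first chord closes, so nothing changes when the second
one does. -/
theorem card_openCrossings_mul_swap {N i : ℕ} {σ : Perm ℕ} (h : σ ∈ involutions N)
    (hi : i ∈ openPoints N σ) :
    (openCrossings (N + 1) (σ * swap i N)).card =
      (openCrossings N σ).card + ((openPoints N σ).filter (i < ·)).card := by
  have hN := (mem_involutions.1 h).2 N le_rfl
  have hi' := mem_openPoints.1 hi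
  have : openCrossings (N + 1) (σ * swap i N) =
      openCrossings N σ ∪ ((openPoints N σ).filter (i < ·)).image (Prod.mk i) := by
    ext ⟨a, c⟩
    rw [Finset.mem_union, Finset.mem_image, mem_openCrossings, mem_openCrossings]
    simp only [Finset.mem_filter, mem_openPoints, Prod.mk.injEq]
    by_cases ha : a = i
    · subst ha
      rw [mul_swap_apply_left, hN, hi'.2]
      constructor
      · rintro ⟨-, h1, h2, h3⟩
        rw [mul_swap_apply_of_ne σ (by omega) (by omega)] at h3
        have := lt_of_mem_involutions h h2
        exact Or.inr ⟨c, ⟨⟨h2, by omega⟩, h1⟩, rfl, rfl⟩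
      · rintro (h1 | ⟨x, ⟨⟨h1, h2⟩, h3⟩, -, rfl⟩)
        · omega
        · rw [mul_swap_apply_of_ne σ (by omega) (by omega)]
          omega
    · have hr : (∃ x, ((x < N ∧ σ x = x) ∧ i < x) ∧ i = a ∧ x = c) ↔ False :=
        ⟨fun ⟨x, _, h1, _⟩ => ha h1.symm, False.elim⟩
      rw [hr, or_false]
      by_cases haN : a = N
      · subst haN
        rw [mul_swap_apply_right, hi'.2]
        omega
      rw [mul_swap_apply_of_ne σ ha haN]
      -- A pair whose second arc was open at `i` stays counted: the first arc ends before `N`, where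
      -- the second now ends.
      by_cases hc : c = i
      · subst hc
        rw [mul_swap_apply_left, hN, hi'.2]
        constructor
        · rintro ⟨h1, h2, h3, -⟩
          exact ⟨⟨by omega, hi'.1⟩, h2, h3, Or.inr rfl⟩
        · rintro ⟨⟨h1, -⟩, h2, h3, -⟩
          have := lt_of_mem_involutions h h1
          exact ⟨⟨by omega, by omega⟩, h2, h3, Or.inl this⟩
      by_cases hcN : c = N
      · subst hcN
        constructor
        · rintro ⟨-, h1, h2, -⟩
          have := lt_of_mem_involutions h h1
          omega
        · omega
      rw [mul_swap_apply_of_ne σ hc hcN]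
      omega
  rw [this, Finset.card_union_of_disjoint, Finset.card_image_of_injective _
    (Prod.mk_right_injective i)]
  rw [Finset.disjoint_left]
  rintro ⟨a, c⟩ h1 h2
  rw [mem_openCrossings] at h1
  obtain ⟨x, -, h3⟩ := Finset.mem_image.1 h2
  obtain ⟨rfl, rfl⟩ := Prod.mk.injEq .. ▸ h3
  have := hi'.2
  omega

/-- The number of larger elements takes each value below the cardinality once. Thus the choice of
which open chord to close contributes a `q`-integer. -/
theorem sum_pow_card_filter_lt {R : Type*} [CommSemiring R] (x : R) (s : Finset ℕ) :
    ∑ i ∈ s, x ^ (s.filter (i < ·)).card = ∑ j ∈ Finset.range s.card, x ^ j := by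
  induction s using Finset.induction_on_min with
  | empty => simp
  | insert a s ha ih =>
    have has : a ∉ s := fun h => (ha a h).false
    rw [Finset.sum_insert has, Finset.card_insert_of_notMem has, Finset.sum_range_succ, ← ih,
      add_comm]
    congr 1
    · refine Finset.sum_congr rfl fun i hi => ?_
      rw [Finset.filter_insert, if_neg (ha i hi).asymm]
    · rw [Finset.filter_insert, if_neg (lt_irrefl a), Finset.filter_true_of_mem ha]

/-- The generating polynomial by (open) crossings of the involutions supported below `N` with `h`
open points. -/
noncomputable def openCrossingPoly {R : Type*} [CommSemiring R] (x : R) (N h : ℕ) : R :=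
  ∑ σ ∈ involutions N, if (openPoints N σ).card = h then x ^ (openCrossings N σ).card else 0

theorem sum_involutions_succ {M : Type*} [AddCommMonoid M] (N : ℕ) (f : Perm ℕ → M) :
    ∑ σ ∈ involutions (N + 1), f σ = ∑ σ ∈ involutions N, f σ +
      ∑ σ ∈ involutions N, ∑ i ∈ openPoints N σ, f (σ * swap i N) := by
  classical
  rw [involutions, Finset.sum_union, Finset.sum_image, Finset.sum_sigma]
  · rintro ⟨σ, i⟩ h1 ⟨τ, j⟩ h2 h
    rw [Finset.mem_coe, Finset.mem_sigma, mem_openPoints] at h1 h2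
    dsimp only at h h1 h2
    have hij : i = j := by
      have := DFunLike.congr_fun h N
      rwa [mul_swap_apply_right, mul_swap_apply_right, h1.2.2, h2.2.2] at this
    subst hij
    rw [mul_right_cancel h]
  · rw [Finset.disjoint_left]
    intro σ h1 h2
    obtain ⟨⟨τ, i⟩, h3, rfl⟩ := Finset.mem_image.1 h2
    rw [Finset.mem_sigma, mem_openPoints] at h3
    have := (mem_involutions.1 h1).2 N le_rfl
    dsimp only at this h3
    rw [mul_swap_apply_right, h3.2.2] at this
    omega

theorem openCrossingPoly_zero {R : Type*} [CommSemiring R] (x : R) (h : ℕ) :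
    openCrossingPoly x 0 h = if h = 0 then 1 else 0 := by
  simp [openCrossingPoly, involutions, openPoints, openCrossings, eq_comm]

/-- The point `N` either opens a chord, creating no crossing, or closes one of the `h + 1` open
chords. -/
theorem openCrossingPoly_succ {R : Type*} [CommSemiring R] (x : R) (N h : ℕ) :
    openCrossingPoly x (N + 1) h =
      (∑ σ ∈ involutions N,
        if (openPoints N σ).card + 1 = h then x ^ (openCrossings N σ).card else 0) +
      (∑ j ∈ Finset.range (h + 1), x ^ j) * openCrossingPoly x N (h + 1) := by
  rw [openCrossingPoly, sum_involutions_succ, openCrossingPoly, Finset.mul_sum]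
  congr 1
  · refine Finset.sum_congr rfl fun σ hσ => ?_
    rw [card_openPoints_succ hσ, openCrossings_succ hσ]
  · refine Finset.sum_congr rfl fun σ hσ => ?_
    by_cases hc : (openPoints N σ).card = h + 1
    · rw [if_pos hc, ← hc, ← sum_pow_card_filter_lt, Finset.sum_mul]
      refine Finset.sum_congr rfl fun i hi => ?_
      have := card_openPoints_mul_swap hσ hi
      rw [if_pos (by omega), card_openCrossings_mul_swap hσ hi, pow_add, mul_comm]
    · rw [if_neg hc, mul_zero]
      refine Finset.sum_eq_zero fun i hi => ?_
      have := card_openPoints_mul_swap hσ hi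
      rw [if_neg (by omega)]

theorem openCrossingPoly_succ_zero {R : Type*} [CommSemiring R] (x : R) (N : ℕ) :
    openCrossingPoly x (N + 1) 0 = openCrossingPoly x N 1 := by
  rw [openCrossingPoly_succ]
  simp

theorem openCrossingPoly_succ_succ {R : Type*} [CommSemiring R] (x : R) (N h : ℕ) :
    openCrossingPoly x (N + 1) (h + 1) = openCrossingPoly x N h +
      (∑ j ∈ Finset.range (h + 2), x ^ j) * openCrossingPoly x N (h + 2) := by
  rw [openCrossingPoly_succ]
  simp [openCrossingPoly]

end Involutions

/-! ### Chord diagrams as involutions without open points -/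

section Bridge

open Equiv

/-- The involution of `ℕ` given by a chord diagram. -/
def ChordDiagram.toPerm {n : ℕ} (D : ChordDiagram n) : Perm ℕ :=
  D.1.extendDomain Fin.equivSubtype

theorem ChordDiagram.toPerm_apply {n : ℕ} (D : ChordDiagram n) (i : Fin (2 * n)) :
    D.toPerm i = D.1 i :=
  D.1.extendDomain_apply_image Fin.equivSubtype i

theorem ChordDiagram.toPerm_apply_of_le {n : ℕ} (D : ChordDiagram n) {x : ℕ} (h : 2 * n ≤ x) :
    D.toPerm x = x :=
  D.1.extendDomain_apply_not_subtype Fin.equivSubtype (by omega)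

theorem ChordDiagram.toPerm_mem {n : ℕ} (D : ChordDiagram n) :
    D.toPerm ∈ involutions (2 * n) := by
  rw [mem_involutions]
  refine ⟨fun x => ?_, fun x hx => D.toPerm_apply_of_le hx⟩
  rcases lt_or_ge x (2 * n) with h | h
  · rw [show x = ((⟨x, h⟩ : Fin (2 * n)) : ℕ) from rfl, D.toPerm_apply, D.toPerm_apply, D.2.1]
  · rw [D.toPerm_apply_of_le h, D.toPerm_apply_of_le h]

theorem ChordDiagram.openPoints_toPerm {n : ℕ} (D : ChordDiagram n) :
    openPoints (2 * n) D.toPerm = ∅ := by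
  rw [Finset.eq_empty_iff_forall_notMem]
  intro x hx
  obtain ⟨h1, h2⟩ := mem_openPoints.1 hx
  have h3 := D.toPerm_apply ⟨x, h1⟩
  rw [h2] at h3
  exact D.2.2 ⟨x, h1⟩ (Fin.ext h3.symm)

theorem ChordDiagram.card_openCrossings_toPerm {n : ℕ} (D : ChordDiagram n) :
    (openCrossings (2 * n) D.toPerm).card = D.crossings := by
  symm
  refine Finset.card_bij (fun p _ => ((p.1 : ℕ), (p.2 : ℕ))) ?_ ?_ ?_
  · rintro ⟨a, c⟩ h
    simp only [Finset.mem_filter, Finset.mem_univ, true_and] at h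
    rw [mem_openCrossings, D.toPerm_apply, D.toPerm_apply]
    exact ⟨⟨a.2, c.2⟩, h.1, h.2.1, Or.inl h.2.2⟩
  · rintro ⟨a, c⟩ _ ⟨b, d⟩ _ h
    simp only [Prod.mk.injEq] at h
    exact Prod.ext (Fin.ext h.1) (Fin.ext h.2)
  · rintro ⟨a, c⟩ h
    rw [mem_openCrossings] at h
    obtain ⟨⟨ha, hc⟩, h1, h2, h3⟩ := h
    refine ⟨(⟨a, ha⟩, ⟨c, hc⟩), ?_, rfl⟩
    have ea := D.toPerm_apply ⟨a, ha⟩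
    have ec := D.toPerm_apply ⟨c, hc⟩
    dsimp only at ea ec
    rw [ea] at h2 h3
    rw [ec] at h3
    simp only [Finset.mem_filter, Finset.mem_univ, true_and]
    refine ⟨h1, h2, h3.resolve_right fun h4 => D.2.2 ⟨c, hc⟩ (Fin.ext h4)⟩

theorem ChordDiagram.toPerm_injective (n : ℕ) :
    Function.Injective (ChordDiagram.toPerm (n := n)) := by
  intro D E h
  refine Subtype.ext (Equiv.ext fun i => Fin.ext ?_)
  rw [← D.toPerm_apply, h, E.toPerm_apply]

theorem ChordDiagram.exists_toPerm_eq {n : ℕ} {σ : Perm ℕ} (h : σ ∈ involutions (2 * n))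
    (h0 : openPoints (2 * n) σ = ∅) : ∃ D : ChordDiagram n, D.toPerm = σ := by
  have hσ := mem_involutions.1 h
  let f : Fin (2 * n) → Fin (2 * n) := fun i => ⟨σ i, lt_of_mem_involutions h i.2⟩
  have hf : Function.Involutive f := fun i => Fin.ext (hσ.1 i)
  refine ⟨⟨hf.toPerm, hf, fun i hi => ?_⟩, ?_⟩
  · have : (i : ℕ) ∈ openPoints (2 * n) σ := mem_openPoints.2 ⟨i.2, congrArg Fin.val hi⟩
    simp [h0] at this
  · ext x
    rcases lt_or_ge x (2 * n) with hx | hx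
    · exact ChordDiagram.toPerm_apply _ (⟨x, hx⟩ : Fin (2 * n))
    · rw [ChordDiagram.toPerm_apply_of_le _ hx, hσ.2 x hx]

theorem chordCount_eq_card (n m : ℕ) : chordCount n m =
    ((involutions (2 * n)).filter fun σ =>
      (openPoints (2 * n) σ).card = 0 ∧ (openCrossings (2 * n) σ).card = m).card := by
  rw [chordCount, ← Nat.card_eq_finsetCard]
  refine Nat.card_eq_of_bijective (fun D => ⟨D.1.toPerm, Finset.mem_filter.2 ⟨D.1.toPerm_mem, by
    rw [D.1.openPoints_toPerm, Finset.card_empty], by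
    rw [D.1.card_openCrossings_toPerm, D.2]⟩⟩) ⟨fun D E h => ?_, fun σ => ?_⟩
  · exact Subtype.ext (ChordDiagram.toPerm_injective n (congrArg Subtype.val h))
  · obtain ⟨h1, h2, h3⟩ := Finset.mem_filter.1 σ.2
    obtain ⟨D, hD⟩ := ChordDiagram.exists_toPerm_eq h1 (Finset.card_eq_zero.1 h2)
    exact ⟨⟨D, by rw [← D.card_openCrossings_toPerm, hD, h3]⟩, Subtype.ext hD⟩

theorem mk_chordCount (n : ℕ) : PowerSeries.mk (fun m => (chordCount n m : ℝ)) =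
    openCrossingPoly (PowerSeries.X : PowerSeries ℝ) (2 * n) 0 := by
  ext m
  rw [PowerSeries.coeff_mk, openCrossingPoly, map_sum, chordCount_eq_card, Finset.card_filter]
  push_cast
  refine Finset.sum_congr rfl fun σ _ => ?_
  by_cases h : (openPoints (2 * n) σ).card = 0
  · simp [h, PowerSeries.coeff_X_pow, eq_comm]
  · simp [h]

end Bridge

/-! ### The Touchard–Riordan formula -/

section TouchardRiordan

variable {R : Type*} [CommRing R] (x : R)

/-- The renormalisation of `openCrossingPoly` by powers of `1 - x`. -/
def normalizedCrossingPoly : ℕ → ℕ → R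
  | 0, 0 => 1
  | 0, _ + 1 => 0
  | N + 1, 0 => (1 - x) * normalizedCrossingPoly N 1
  | N + 1, h + 1 => normalizedCrossingPoly N h + (1 - x ^ (h + 2)) * normalizedCrossingPoly N (h + 2)

theorem normalizedCrossingPoly_eq_zero {N h : ℕ} (hN : N < h) :
    normalizedCrossingPoly x N h = 0 := by
  induction N generalizing h with
  | zero => obtain ⟨h, rfl⟩ := Nat.exists_eq_succ_of_ne_zero hN.ne'; rfl
  | succ N ih =>
    obtain ⟨h, rfl⟩ := Nat.exists_eq_succ_of_ne_zero (by omega : h ≠ 0)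
    rw [Nat.succ_eq_add_one, normalizedCrossingPoly, ih (by omega), ih (by omega)]
    ring

theorem openCrossingPoly_eq_zero {N h : ℕ} (hN : N < h) : openCrossingPoly x N h = 0 := by
  refine Finset.sum_eq_zero fun σ _ => if_neg fun h1 => ?_
  have : (openPoints N σ).card ≤ (Finset.range N).card := Finset.card_filter_le _ _
  rw [Finset.card_range] at this
  omega

/-- Here `k` counts closed chords. One factor `1 - x` per closing collapses the geometric sum of
weights to `1 - x ^ (h + 1)`, with `h + 1` chords open before the closing. -/
theorem normalizedCrossingPoly_eq_pow_mul {N h k : ℕ} (hN : N = h + 2 * k) :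
    normalizedCrossingPoly x N h = (1 - x) ^ k * openCrossingPoly x N h := by
  induction N generalizing h k with
  | zero =>
    obtain ⟨rfl, rfl⟩ : h = 0 ∧ k = 0 := by omega
    simp [normalizedCrossingPoly, openCrossingPoly_zero]
  | succ N ih =>
    rcases h with _ | h
    · obtain ⟨k, rfl⟩ := Nat.exists_eq_succ_of_ne_zero (by omega : k ≠ 0)
      rw [normalizedCrossingPoly, openCrossingPoly_succ_zero, ih (k := k) (by omega),
        Nat.succ_eq_add_one]
      ring
    · rw [normalizedCrossingPoly, openCrossingPoly_succ_succ, ih (k := k) (h := h) (by omega)]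
      rcases k with _ | k
      · rw [normalizedCrossingPoly_eq_zero x (by omega : N < h + 2),
          openCrossingPoly_eq_zero x (by omega : N < h + 2)]
        ring
      · rw [ih (k := k) (h := h + 2) (by omega), ← mul_neg_geom_sum]
        ring

theorem touchardRiordan_coeff_zero (k : ℕ) :
    (-1) ^ k * x ^ (k + 1).choose 2 * gaussBinom x 0 k +
      (-1) ^ (k + 1) * x ^ (k + 2).choose 2 * gaussBinom x 0 (k + 1) =
    (1 - x) * ((-1) ^ k * x ^ (k + 1).choose 2 * gaussBinom x 1 k) := by
  have h := (gaussBinom_absorb x 0 k).2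
  simp only [gaussBinom_zero_left, zero_add, pow_one, mul_one] at h
  rw [choose_succ_two, gaussBinom_zero_left, gaussBinom_zero_left]
  linear_combination -(-1) ^ k * x ^ (k + 1).choose 2 * h

theorem touchardRiordan_coeff_succ (h k : ℕ) :
    (-1) ^ (k + 1) * x ^ (k + 2).choose 2 * gaussBinom x (h + 1) (k + 1) +
      (-1) ^ k * x ^ (k + 1).choose 2 * gaussBinom x (h + 1) k =
    (-1) ^ (k + 1) * x ^ (k + 2).choose 2 * gaussBinom x h (k + 1) +
      (1 - x ^ (h + 2)) * ((-1) ^ k * x ^ (k + 1).choose 2 * gaussBinom x (h + 2) k) := by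
  have h1 := (gaussBinom_absorb x (h + 1) k).2
  rw [choose_succ_two, gaussBinom_succ_succ' x h k]
  linear_combination -(-1) ^ k * x ^ (k + 1).choose 2 * h1

/-- Both sides obey the same recurrence in `N`: after expanding the ballot numbers by their last
step, the coefficient of each one matches by `touchardRiordan_coeff_zero` or
`touchardRiordan_coeff_succ`. The cutoff `M` is free, since ballot numbers vanish beyond it, and the
index shifts in the induction need this freedom. -/
theorem normalizedCrossingPoly_eq_sum {N h M : ℕ} (hM : N < M) :
    normalizedCrossingPoly x N h = ∑ k ∈ Finset.range M,
      (-1) ^ k * x ^ (k + 1).choose 2 * gaussBinom x h k * ballot N (h + 2 * k) := by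
  induction N generalizing h M with
  | zero =>
    obtain ⟨M, rfl⟩ := Nat.exists_eq_succ_of_ne_zero hM.ne'
    rw [Nat.succ_eq_add_one, Finset.sum_range_succ', Finset.sum_eq_zero]
    · rcases h with _ | h <;> simp [normalizedCrossingPoly, ballot]
    · intro k _
      rw [ballot_eq_zero (by omega)]
      simp
  | succ N ih =>
    obtain ⟨M, rfl⟩ := Nat.exists_eq_succ_of_ne_zero (by omega : M ≠ 0)
    rw [Nat.succ_eq_add_one]
    rcases h with _ | h
    · rw [normalizedCrossingPoly, ih (M := M) (by omega), Finset.sum_range_succ' _ M]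
      have e : ∀ k, ballot (N + 1) (0 + 2 * (k + 1)) =
          ballot N (1 + 2 * k) + ballot N (1 + 2 * (k + 1)) := fun k => by
        rw [show 0 + 2 * (k + 1) = (1 + 2 * k) + 1 by ring, ballot]
        congr 2
      have h1 := Finset.sum_range_succ' (fun k => (-1) ^ k * x ^ (k + 1).choose 2 *
        gaussBinom x 0 k * (ballot N (1 + 2 * k) : R)) M
      rw [Finset.sum_range_succ, ballot_eq_zero (by omega : N < 1 + 2 * M)] at h1
      have e0 : ballot (N + 1) (0 + 2 * 0) = ballot N (1 + 2 * 0) := rfl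
      have hR : ∑ k ∈ Finset.range M, (-1) ^ (k + 1) * x ^ (k + 1 + 1).choose 2 *
          gaussBinom x 0 (k + 1) * (ballot (N + 1) (0 + 2 * (k + 1)) : R) =
          ∑ k ∈ Finset.range M, (-1) ^ (k + 1) * x ^ (k + 1 + 1).choose 2 *
            gaussBinom x 0 (k + 1) * (ballot N (1 + 2 * k) : R) +
          ∑ k ∈ Finset.range M, (-1) ^ (k + 1) * x ^ (k + 1 + 1).choose 2 *
            gaussBinom x 0 (k + 1) * (ballot N (1 + 2 * (k + 1)) : R) := by
        rw [← Finset.sum_add_distrib]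
        refine Finset.sum_congr rfl fun k _ => ?_
        rw [e, Nat.cast_add, mul_add]
      have hS : (1 - x) * ∑ k ∈ Finset.range M, (-1) ^ k * x ^ (k + 1).choose 2 *
            gaussBinom x 1 k * (ballot N (1 + 2 * k) : R) =
          ∑ k ∈ Finset.range M, (-1) ^ k * x ^ (k + 1).choose 2 *
            gaussBinom x 0 k * (ballot N (1 + 2 * k) : R) +
          ∑ k ∈ Finset.range M, (-1) ^ (k + 1) * x ^ (k + 1 + 1).choose 2 *
            gaussBinom x 0 (k + 1) * (ballot N (1 + 2 * k) : R) := by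
        rw [← Finset.sum_add_distrib, Finset.mul_sum]
        refine Finset.sum_congr rfl fun k _ => ?_
        linear_combination -(ballot N (1 + 2 * k) : R) * touchardRiordan_coeff_zero x k
      rw [hR, hS, e0]
      push_cast at h1
      linear_combination h1
    · rw [normalizedCrossingPoly, ih (h := h) (M := M + 1) (by omega),
        ih (h := h + 2) (M := M) (by omega)]
      have e : ∀ k, ballot (N + 1) (h + 1 + 2 * k) =
          ballot N (h + 2 * k) + ballot N (h + 2 * (k + 1)) := fun k => by
        rw [show h + 1 + 2 * k = (h + 2 * k) + 1 by ring, ballot]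
        congr 2
      have h1 := Finset.sum_range_succ' (fun k => (-1) ^ k * x ^ (k + 1).choose 2 *
        gaussBinom x (h + 1) k * (ballot N (h + 2 * (k + 1)) : R)) M
      rw [Finset.sum_range_succ, ballot_eq_zero (by omega : N < h + 2 * (M + 1))] at h1
      rw [Finset.sum_range_succ' _ M, Finset.sum_range_succ' _ M]
      have hR : ∑ k ∈ Finset.range M, (-1) ^ (k + 1) * x ^ (k + 1 + 1).choose 2 *
          gaussBinom x (h + 1) (k + 1) * (ballot (N + 1) (h + 1 + 2 * (k + 1)) : R) =
          ∑ k ∈ Finset.range M, (-1) ^ (k + 1) * x ^ (k + 1 + 1).choose 2 *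
            gaussBinom x (h + 1) (k + 1) * (ballot N (h + 2 * (k + 1)) : R) +
          ∑ k ∈ Finset.range M, (-1) ^ (k + 1) * x ^ (k + 1 + 1).choose 2 *
            gaussBinom x (h + 1) (k + 1) * (ballot N (h + 2 * (k + 1 + 1)) : R) := by
        rw [← Finset.sum_add_distrib]
        refine Finset.sum_congr rfl fun k _ => ?_
        rw [e, Nat.cast_add, mul_add]
      have hS : ∑ k ∈ Finset.range M, (-1) ^ (k + 1) * x ^ (k + 1 + 1).choose 2 *
            gaussBinom x h (k + 1) * (ballot N (h + 2 * (k + 1)) : R) +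
          (1 - x ^ (h + 2)) * ∑ k ∈ Finset.range M, (-1) ^ k * x ^ (k + 1).choose 2 *
            gaussBinom x (h + 2) k * (ballot N (h + 2 + 2 * k) : R) =
          ∑ k ∈ Finset.range M, (-1) ^ (k + 1) * x ^ (k + 1 + 1).choose 2 *
            gaussBinom x (h + 1) (k + 1) * (ballot N (h + 2 * (k + 1)) : R) +
          ∑ k ∈ Finset.range M, (-1) ^ k * x ^ (k + 1).choose 2 *
            gaussBinom x (h + 1) k * (ballot N (h + 2 * (k + 1)) : R) := by
        rw [← Finset.sum_add_distrib, Finset.mul_sum, ← Finset.sum_add_distrib]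
        refine Finset.sum_congr rfl fun k _ => ?_
        rw [show h + 2 + 2 * k = h + 2 * (k + 1) by ring]
        linear_combination -(ballot N (h + 2 * (k + 1)) : R) * touchardRiordan_coeff_succ x h k
      rw [hR, e 0]
      simp only [gaussBinom_zero_right] at h1 ⊢
      push_cast at h1 ⊢
      linear_combination hS + h1

end TouchardRiordan

section TouchardRiordanSeries

/-- The power series `∑ k, c k * X ^ (k (k + 1) / 2)`. -/
noncomputable def triangularSeries (c : ℕ → ℝ) : PowerSeries ℝ :=
  PowerSeries.mk fun t => ∑ k ∈ Finset.range (t + 1), if (k + 1).choose 2 = t then c k else 0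

theorem coeff_triangularSeries (c : ℕ → ℝ) (t : ℕ) : PowerSeries.coeff t (triangularSeries c) =
    ∑ k ∈ Finset.range (t + 1), if (k + 1).choose 2 = t then c k else 0 :=
  PowerSeries.coeff_mk _ _

/-- The Touchard–Riordan formula. -/
theorem touchardRiordan (n : ℕ) :
    (1 - PowerSeries.X) ^ n * PowerSeries.mk (fun m => (chordCount n m : ℝ)) =
      triangularSeries fun k => (-1) ^ k * evenBallot n k := by
  rw [mk_chordCount, ← normalizedCrossingPoly_eq_pow_mul _ (by ring : 2 * n = 0 + 2 * n)]
  ext t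
  -- The cutoff exceeds both `2 n` and `t`; terms with `k > t` cannot reach degree `t`, as `k ≤ k (k
  -- + 1) / 2`.
  rw [normalizedCrossingPoly_eq_sum _ (by omega : 2 * n < 2 * n + 1 + (t + 1)), map_sum,
    coeff_triangularSeries]
  have h : ∀ k, PowerSeries.coeff t ((-1 : PowerSeries ℝ) ^ k *
      PowerSeries.X ^ (k + 1).choose 2 * gaussBinom PowerSeries.X 0 k *
        ((ballot (2 * n) (0 + 2 * k) : ℕ) : PowerSeries ℝ)) =
      if (k + 1).choose 2 = t then (-1) ^ k * (evenBallot n k : ℝ) else 0 := fun k => by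
    have e : (-1 : PowerSeries ℝ) ^ k *
        PowerSeries.X ^ (k + 1).choose 2 * gaussBinom PowerSeries.X 0 k *
        ((ballot (2 * n) (0 + 2 * k) : ℕ) : PowerSeries ℝ) =
        PowerSeries.C ((-1) ^ k * (evenBallot n k : ℝ)) * PowerSeries.X ^ (k + 1).choose 2 := by
      rw [gaussBinom_zero_left, zero_add, evenBallot]
      simp only [map_mul, map_pow, map_neg, map_one, map_natCast]
      ring
    rw [e, PowerSeries.coeff_C_mul, PowerSeries.coeff_X_pow]
    simp [eq_comm]
  simp only [h]
  symm
  refine Finset.sum_subset (Finset.range_subset_range.2 (by omega)) fun k _ hk => if_neg fun hkt => ?_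
  have := le_succ_choose_two k
  rw [Finset.mem_range] at hk
  omega

end TouchardRiordanSeries

/-! ### Subexponential sequences of Catalan type -/

section Regular

/-- The sequence `a` is `O(scaledCatalan)` with constant `D`, asymptotic to `α * scaledCatalan`,
and has sum `s`. -/
structure CatalanRegular (a : ℕ → ℝ) (α s D : ℝ) : Prop where
  bound : ∀ n, |a n| ≤ D * scaledCatalan n
  lim : Tendsto (fun n => a n / scaledCatalan n) atTop (nhds α)
  sum : HasSum a s

theorem scaledCatalan_convolution (n : ℕ) :
    ∑ p ∈ Finset.HasAntidiagonal.antidiagonal n, scaledCatalan p.1 * scaledCatalan p.2 =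
      4 * scaledCatalan (n + 1) := by
  have h : (catalan (n + 1) : ℝ) =
      ∑ p ∈ Finset.HasAntidiagonal.antidiagonal n, (catalan p.1 : ℝ) * catalan p.2 := by
    rw [catalan_succ']; push_cast; rfl
  have h4 : (4 : ℝ) * scaledCatalan (n + 1) = catalan (n + 1) / 4 ^ n := by
    rw [scaledCatalan, pow_succ]; field_simp
  rw [h4, h, Finset.sum_div]
  refine Finset.sum_congr rfl fun p hp => ?_
  rw [scaledCatalan, scaledCatalan, div_mul_div_comm, ← pow_add, Finset.HasAntidiagonal.mem_antidiagonal.1 hp]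

/-- Since `k ^ 2 * scaledCatalan k` is nondecreasing, at most halving the index costs a factor of at
most `2 ^ 2`. -/
theorem scaledCatalan_sub_le {n i : ℕ} (h : 2 * i ≤ n) :
    scaledCatalan (n - i) ≤ 4 * scaledCatalan n := by
  have hmono : Monotone fun k : ℕ => (k : ℝ) ^ 2 * scaledCatalan k := by
    refine monotone_nat_of_le_succ fun k => ?_
    have hk : (0 : ℝ) ≤ k := Nat.cast_nonneg k
    have e : ((k + 1 : ℕ) : ℝ) ^ 2 * scaledCatalan (k + 1) =
        ((k + 1) ^ 2 * (2 * k + 1) / (2 * (k + 2))) * scaledCatalan k := by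
      rw [scaledCatalan_succ]; push_cast; ring
    rw [e]
    refine mul_le_mul_of_nonneg_right ?_ (scaledCatalan_pos k).le
    rw [le_div_iff₀ (by positivity)]
    nlinarith [pow_nonneg hk 2, pow_nonneg hk 3]
  rcases Nat.eq_zero_or_pos n with rfl | hn
  · have := scaledCatalan_pos 0
    simp only [Nat.zero_sub]
    linarith
  have h1 := hmono (Nat.sub_le n i)
  dsimp only at h1
  have h2 : (n : ℝ) ≤ 2 * ((n - i : ℕ) : ℝ) := by exact_mod_cast (by omega : n ≤ 2 * (n - i))
  have h3 : (0 : ℝ) < ((n - i : ℕ) : ℝ) := by exact_mod_cast (by omega : 0 < n - i)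
  have h4 : ((n - i : ℕ) : ℝ) ^ 2 * scaledCatalan (n - i) ≤
      ((n - i : ℕ) : ℝ) ^ 2 * (4 * scaledCatalan n) := by
    refine h1.trans ?_
    have h5 : (n : ℝ) ^ 2 ≤ 4 * ((n - i : ℕ) : ℝ) ^ 2 := by
      have := pow_le_pow_left₀ (Nat.cast_nonneg n) h2 2
      linarith
    calc (n : ℝ) ^ 2 * scaledCatalan n ≤ 4 * ((n - i : ℕ) : ℝ) ^ 2 * scaledCatalan n :=
          mul_le_mul_of_nonneg_right h5 (scaledCatalan_pos n).le
      _ = _ := by ring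
  exact le_of_mul_le_mul_left h4 (by positivity)

theorem tendsto_sub_div_scaledCatalan {b : ℕ → ℝ} {β : ℝ}
    (hb : Tendsto (fun n => b n / scaledCatalan n) atTop (nhds β)) (i : ℕ) :
    Tendsto (fun n => b (n - i) / scaledCatalan n) atTop (nhds β) := by
  have hg : Tendsto (fun n => scaledCatalan (n + i) / scaledCatalan n) atTop (nhds 1) := by
    induction i with
    | zero => simp [div_self (scaledCatalan_pos _).ne']
    | succ i ih =>
      simpa only [add_right_comm _ 1 i, add_assoc] using
        tendsto_shift_div_scaledCatalan (u := fun n => scaledCatalan (n + i)) ih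
  rw [← tendsto_add_atTop_iff_nat i]
  have h := hb.div hg one_ne_zero
  rw [div_one] at h
  refine h.congr fun n => ?_
  have h1 := (scaledCatalan_pos n).ne'
  have h2 := (scaledCatalan_pos (n + i)).ne'
  rw [Pi.div_apply, Nat.add_sub_cancel]
  field_simp

namespace CatalanRegular

variable {a b : ℕ → ℝ} {α β s t D E : ℝ}

theorem const_nonneg (ha : CatalanRegular a α s D) : 0 ≤ D := by
  have := (abs_nonneg _).trans (ha.bound 0)
  rwa [scaledCatalan_zero, mul_one] at this

theorem abs_lim_le (ha : CatalanRegular a α s D) : |α| ≤ D := by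
  refine le_of_tendsto' ha.lim.abs fun n => ?_
  rw [abs_div, abs_of_pos (scaledCatalan_pos n), div_le_iff₀ (scaledCatalan_pos n)]
  exact ha.bound n

theorem summable_norm (ha : CatalanRegular a α s D) : Summable fun n => ‖a n‖ :=
  Summable.of_nonneg_of_le (fun _ => norm_nonneg _) ha.bound
    (hasSum_scaledCatalan.summable.mul_left D)

/-- Dominated convergence: below the cutoff `2 i ≤ n`, so `b (n - i)` is comparable to
`scaledCatalan n` uniformly in `i`, while `a` is absolutely summable. -/
theorem tendsto_half_convolution (ha : CatalanRegular a α s D) (hb : CatalanRegular b β t E)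
    {c : ℕ → ℕ} (hc : ∀ n, 2 * c n ≤ n + 2) (hc' : Tendsto c atTop atTop) :
    Tendsto (fun n => (∑ i ∈ Finset.range (c n), a i * b (n - i)) / scaledCatalan n) atTop
      (nhds (s * β)) := by
  have hD := ha.const_nonneg
  have hE := hb.const_nonneg
  have key : Tendsto (fun n => ∑' i, if i < c n then a i * b (n - i) / scaledCatalan n else 0)
      atTop (nhds (∑' i, a i * β)) := by
    refine tendsto_tsum_of_dominated_convergence (bound := fun i => ‖a i‖ * (4 * E))
      (ha.summable_norm.mul_right _) (fun i => ?_) ?_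
    · refine ((tendsto_sub_div_scaledCatalan hb.lim i).const_mul (a i)).congr' ?_
      filter_upwards [hc'.eventually_gt_atTop i] with n hn
      rw [if_pos hn, mul_div_assoc]
    · filter_upwards with n i
      have hg := scaledCatalan_pos n
      split_ifs with hi
      · rw [norm_div, norm_mul, Real.norm_of_nonneg hg.le, Real.norm_eq_abs (b _),
          mul_div_assoc]
        refine mul_le_mul_of_nonneg_left ?_ (norm_nonneg _)
        rw [div_le_iff₀ hg]
        have h1 := hc n
        calc |b (n - i)| ≤ E * scaledCatalan (n - i) := hb.bound _
          _ ≤ E * (4 * scaledCatalan n) :=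
            mul_le_mul_of_nonneg_left (scaledCatalan_sub_le (by omega)) hE
          _ = _ := by ring
      · rw [norm_zero]; positivity
  rw [tsum_mul_right, ha.sum.tsum_eq] at key
  refine key.congr fun n => ?_
  rw [tsum_eq_sum (s := Finset.range (c n)), Finset.sum_div]
  · exact Finset.sum_congr rfl fun i hi => if_pos (Finset.mem_range.1 hi)
  · exact fun i hi => if_neg fun h => hi (Finset.mem_range.2 h)

theorem convolution (ha : CatalanRegular a α s D) (hb : CatalanRegular b β t E) :
    CatalanRegular (fun n => ∑ p ∈ Finset.HasAntidiagonal.antidiagonal n, a p.1 * b p.2)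
      (α * t + s * β) (s * t) (4 * (D * E)) where
  bound n := by
    have hD := ha.const_nonneg
    have hE := hb.const_nonneg
    calc |∑ p ∈ Finset.HasAntidiagonal.antidiagonal n, a p.1 * b p.2|
        ≤ ∑ p ∈ Finset.HasAntidiagonal.antidiagonal n, |a p.1 * b p.2| := Finset.abs_sum_le_sum_abs _ _
      _ ≤ ∑ p ∈ Finset.HasAntidiagonal.antidiagonal n, D * E * (scaledCatalan p.1 * scaledCatalan p.2) := by
          refine Finset.sum_le_sum fun p _ => ?_
          rw [abs_mul, mul_mul_mul_comm]
          exact mul_le_mul (ha.bound _) (hb.bound _) (abs_nonneg _)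
            (mul_nonneg hD (scaledCatalan_pos _).le)
      _ = D * E * (4 * scaledCatalan (n + 1)) := by
          rw [← Finset.mul_sum, scaledCatalan_convolution]
      _ ≤ D * E * (4 * scaledCatalan n) := by
          have := scaledCatalan_succ_le n
          gcongr
      _ = _ := by ring
  lim := by
    -- The indices `i ≤ n / 2` give `s * β`; the other `n - n / 2` indices, after reflection, give
    -- `α * t`.
    have h1 := ha.tendsto_half_convolution hb (c := fun n => n / 2 + 1) (fun n => by omega)
      (tendsto_atTop_mono (fun n => Nat.le_succ _) (Nat.tendsto_div_const_atTop two_ne_zero))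
    have h2 := hb.tendsto_half_convolution ha (c := fun n => n - n / 2) (fun n => by omega)
      (tendsto_atTop_mono (fun n => (by omega : n / 2 ≤ n - n / 2))
        (Nat.tendsto_div_const_atTop two_ne_zero))
    have h3 := h2.add h1
    rw [mul_comm t α] at h3
    refine h3.congr fun n => ?_
    rw [← add_div]
    congr 1
    rw [Finset.Nat.sum_antidiagonal_eq_sum_range_succ fun i j => a i * b j,
      ← Finset.sum_range_add_sum_Ico _ (by omega : n / 2 + 1 ≤ n.succ), add_comm]
    congr 1
    have h4 := Finset.sum_Ico_reflect (fun i => a i * b (n - i)) 0 (m := n - n / 2) (n := n)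
      (by omega)
    rw [show n + 1 - (n - n / 2) = n / 2 + 1 by omega, Nat.sub_zero] at h4
    rw [Finset.range_eq_Ico, Nat.succ_eq_add_one, ← h4]
    refine Finset.sum_congr rfl fun i hi => ?_
    rw [Finset.mem_Ico] at hi
    rw [Nat.sub_sub_self (by omega), mul_comm]
  sum := by
    have h1 := tsum_mul_tsum_eq_tsum_sum_antidiagonal_of_summable_norm ha.summable_norm
      hb.summable_norm
    have h2 := (summable_norm_sum_mul_antidiagonal_of_summable_norm ha.summable_norm
      hb.summable_norm).of_norm
    rw [ha.sum.tsum_eq, hb.sum.tsum_eq] at h1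
    rw [h1]
    exact h2.hasSum

theorem finset_sum {ι : Type*} (S : Finset ι) {f : ι → ℕ → ℝ} {α s D : ι → ℝ}
    (h : ∀ i ∈ S, CatalanRegular (f i) (α i) (s i) (D i)) :
    CatalanRegular (fun n => ∑ i ∈ S, f i n) (∑ i ∈ S, α i) (∑ i ∈ S, s i) (∑ i ∈ S, D i) where
  bound n := by
    rw [Finset.sum_mul]
    exact (Finset.abs_sum_le_sum_abs _ _).trans (Finset.sum_le_sum fun i hi => (h i hi).bound n)
  lim := by
    simp only [Finset.sum_div]
    exact tendsto_finsetSum _ fun i hi => (h i hi).lim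
  sum := hasSum_sum fun i hi => (h i hi).sum

end CatalanRegular

end Regular

/-! ### Evaluating power series on `[0, 1)` -/

section DiskSummable

/-- Absolute convergence on the unit interval. -/
def DiskSummable (p : PowerSeries ℝ) : Prop :=
  ∀ r : ℝ, 0 ≤ r → r < 1 → Summable fun t => ‖PowerSeries.coeff t p * r ^ t‖

/-- The value of a power series at a real number. -/
noncomputable def seriesEval (r : ℝ) (p : PowerSeries ℝ) : ℝ :=
  ∑' t, PowerSeries.coeff t p * r ^ t

theorem coeff_mul_mul_pow (p q : PowerSeries ℝ) (r : ℝ) (t : ℕ) :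
    PowerSeries.coeff t (p * q) * r ^ t = ∑ x ∈ Finset.HasAntidiagonal.antidiagonal t,
      (PowerSeries.coeff x.1 p * r ^ x.1) * (PowerSeries.coeff x.2 q * r ^ x.2) := by
  rw [PowerSeries.coeff_mul, Finset.sum_mul]
  refine Finset.sum_congr rfl fun x hx => ?_
  rw [← Finset.HasAntidiagonal.mem_antidiagonal.1 hx, pow_add]
  ring

theorem DiskSummable.mul {p q : PowerSeries ℝ} (hp : DiskSummable p) (hq : DiskSummable q) :
    DiskSummable (p * q) := fun r h0 h1 => by
  simp only [coeff_mul_mul_pow]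
  exact summable_norm_sum_mul_antidiagonal_of_summable_norm
    (f := fun i => PowerSeries.coeff i p * r ^ i) (g := fun i => PowerSeries.coeff i q * r ^ i)
    (hp r h0 h1) (hq r h0 h1)

theorem diskSummable_C (c : ℝ) : DiskSummable (PowerSeries.C c) := fun r _ _ =>
  summable_of_ne_finset_zero (s := {0}) fun t ht => by
    rw [PowerSeries.coeff_C, if_neg (by simpa using ht), zero_mul, norm_zero]

theorem DiskSummable.pow {p : PowerSeries ℝ} (hp : DiskSummable p) (l : ℕ) :
    DiskSummable (p ^ l) := by
  induction l with
  | zero => simpa using diskSummable_C 1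
  | succ l ih => rw [pow_succ]; exact ih.mul hp

theorem seriesEval_mul {p q : PowerSeries ℝ} (hp : DiskSummable p) (hq : DiskSummable q) {r : ℝ}
    (h0 : 0 ≤ r) (h1 : r < 1) : seriesEval r (p * q) = seriesEval r p * seriesEval r q := by
  simp only [seriesEval, coeff_mul_mul_pow]
  exact (tsum_mul_tsum_eq_tsum_sum_antidiagonal_of_summable_norm (hp r h0 h1) (hq r h0 h1)).symm

theorem seriesEval_C (r c : ℝ) : seriesEval r (PowerSeries.C c) = c := by
  rw [seriesEval, tsum_eq_single 0]
  · simp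
  · intro t ht
    rw [PowerSeries.coeff_C, if_neg ht, zero_mul]

theorem seriesEval_pow {p : PowerSeries ℝ} (hp : DiskSummable p) {r : ℝ}
    (h0 : 0 ≤ r) (h1 : r < 1) (l : ℕ) : seriesEval r (p ^ l) = seriesEval r p ^ l := by
  induction l with
  | zero => simpa using seriesEval_C r 1
  | succ l ih => rw [pow_succ, seriesEval_mul (hp.pow l) hp h0 h1, ih, pow_succ]

theorem strictMono_succ_choose_two : StrictMono fun k : ℕ => (k + 1).choose 2 :=
  strictMono_nat_of_lt_succ fun k => by rw [choose_succ_two]; omega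

theorem coeff_choose_triangularSeries (c : ℕ → ℝ) (k : ℕ) :
    PowerSeries.coeff ((k + 1).choose 2) (triangularSeries c) = c k := by
  rw [coeff_triangularSeries, Finset.sum_eq_single k, if_pos rfl]
  · exact fun j _ hj => if_neg fun h => hj (strictMono_succ_choose_two.injective h)
  · intro h
    rw [Finset.mem_range] at h
    have := le_succ_choose_two k
    omega

theorem coeff_triangularSeries_eq_zero (c : ℕ → ℝ) {t : ℕ}
    (ht : t ∉ Set.range fun k : ℕ => (k + 1).choose 2) :
    PowerSeries.coeff t (triangularSeries c) = 0 := by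
  rw [coeff_triangularSeries]
  exact Finset.sum_eq_zero fun k _ => if_neg fun h => ht ⟨k, h⟩

theorem diskSummable_triangularSeries {c : ℕ → ℝ} {b : ℝ}
    (hc : ∀ k, |c k| ≤ b * (2 * k + 1)) : DiskSummable (triangularSeries c) := fun r h0 h1 => by
  rw [← strictMono_succ_choose_two.injective.summable_iff]
  · refine Summable.of_nonneg_of_le (fun _ => norm_nonneg _) (fun k => ?_)
      ((summable_linear_mul_pow h0 h1).mul_left b)
    rw [Function.comp_apply, coeff_choose_triangularSeries, norm_mul,
      Real.norm_of_nonneg (pow_nonneg h0 _), Real.norm_eq_abs, ← mul_assoc]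
    exact mul_le_mul (hc k) (pow_succ_choose_two_le h0 h1 k) (pow_nonneg h0 _)
      ((abs_nonneg _).trans (hc k))
  · intro t ht
    rw [coeff_triangularSeries_eq_zero c ht, zero_mul, norm_zero]

theorem seriesEval_triangularSeries (c : ℕ → ℝ) (r : ℝ) :
    seriesEval r (triangularSeries c) = ∑' k : ℕ, c k * r ^ (k + 1).choose 2 := by
  rw [seriesEval, ← strictMono_succ_choose_two.injective.tsum_eq]
  · simp only [coeff_choose_triangularSeries]
  · intro t ht
    by_contra h
    exact ht (by dsimp only; rw [coeff_triangularSeries_eq_zero c h, zero_mul])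

end DiskSummable

/-! ### Powers of the rescaled generating function -/

section RegularFamily

/-- A bivariate series all of whose coefficient sequences in the inner variable, divided by
`4 ^ n`, are `CatalanRegular`. -/
def RegularFamily (A : PowerSeries (PowerSeries ℝ)) (α S D : PowerSeries ℝ) : Prop :=
  ∀ t, CatalanRegular (fun n => PowerSeries.coeff t (PowerSeries.coeff n A) / 4 ^ n)
    (PowerSeries.coeff t α) (PowerSeries.coeff t S) (PowerSeries.coeff t D)

theorem RegularFamily.mul {A B : PowerSeries (PowerSeries ℝ)} {α β S T D E : PowerSeries ℝ}
    (hA : RegularFamily A α S D) (hB : RegularFamily B β T E) :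
    RegularFamily (A * B) (α * T + S * β) (S * T) (PowerSeries.C 4 * (D * E)) := fun t => by
  have h := CatalanRegular.finset_sum (Finset.HasAntidiagonal.antidiagonal t)
    fun x _ => (hA x.1).convolution (hB x.2)
  convert h using 1
  · funext n
    rw [PowerSeries.coeff_mul, map_sum, Finset.sum_comm, Finset.sum_div]
    refine Finset.sum_congr rfl fun p hp => ?_
    rw [PowerSeries.coeff_mul, Finset.sum_div]
    refine Finset.sum_congr rfl fun x _ => ?_
    rw [← Finset.HasAntidiagonal.mem_antidiagonal.1 hp, pow_add]
    ring
  · rw [map_add, PowerSeries.coeff_mul, PowerSeries.coeff_mul, Finset.sum_add_distrib]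
  · rw [PowerSeries.coeff_mul]
  · rw [PowerSeries.coeff_C_mul, PowerSeries.coeff_mul, Finset.mul_sum]

/-- The pair of limit and sum multiplies like a dual number `S + ε α`, whence the derivative-like
formula. The bounds must also remain summable in `x`, so they are carried as a series `E`. -/
theorem RegularFamily.pow {A : PowerSeries (PowerSeries ℝ)} {α S D : PowerSeries ℝ}
    (hA : RegularFamily A α S D) (hD : DiskSummable D) (l : ℕ) :
    ∃ E, DiskSummable E ∧
      RegularFamily (A ^ (l + 1)) (PowerSeries.C ((l : ℝ) + 1) * (α * S ^ l)) (S ^ (l + 1)) E := by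
  induction l with
  | zero => exact ⟨D, hD, by simpa using hA⟩
  | succ l ih =>
    obtain ⟨E, hE, h⟩ := ih
    refine ⟨PowerSeries.C 4 * (E * D), (diskSummable_C 4).mul (hE.mul hD), ?_⟩
    convert h.mul hA using 1
    · exact pow_succ A (l + 1)
    · push_cast
      simp only [map_add, map_one]
      ring
    · exact pow_succ S (l + 1)

/-- The series `∑ n, y ^ n ∑ k, (-1) ^ k b_{n, k} x ^ (k (k + 1) / 2)`. -/
noncomputable def ballotSeries : PowerSeries (PowerSeries ℝ) :=
  PowerSeries.mk fun n => triangularSeries fun k => (-1) ^ k * evenBallot n k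

theorem rescale_chordSeries :
    PowerSeries.rescale (1 - PowerSeries.X : PowerSeries ℝ) chordSeries = ballotSeries := by
  ext1 n
  rw [PowerSeries.coeff_rescale, chordSeries, ballotSeries, PowerSeries.coeff_mk,
    PowerSeries.coeff_mk, touchardRiordan]

theorem regularFamily_ballotSeries :
    RegularFamily ballotSeries (triangularSeries fun k => (-1) ^ k * (2 * k + 1))
      (triangularSeries fun k => 2 * (-1) ^ k) (triangularSeries fun k => 2 * k + 1) := fun t => by
  have h := CatalanRegular.finset_sum (Finset.range (t + 1))
    (f := fun k n => if (k + 1).choose 2 = t then (-1) ^ k * scaledBallot n k else 0)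
    (α := fun k => if (k + 1).choose 2 = t then (-1) ^ k * (2 * k + 1) else 0)
    (s := fun k => if (k + 1).choose 2 = t then 2 * (-1) ^ k else 0)
    (D := fun k => if (k + 1).choose 2 = t then 2 * k + 1 else 0) fun k _ => by
      split_ifs
      · refine ⟨fun n => ?_, ?_, ?_⟩
        · rw [abs_mul, abs_pow, abs_neg, abs_one, one_pow, one_mul,
            abs_of_nonneg (scaledBallot_nonneg n k)]
          exact scaledBallot_le n k
        · simpa only [mul_div_assoc] using (tendsto_scaledBallot k).const_mul ((-1) ^ k)
        · rw [mul_comm 2]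
          exact (hasSum_scaledBallot k).mul_left _
      · exact ⟨fun n => by simp, by simp, hasSum_zero⟩
  simp only [coeff_triangularSeries]
  convert h using 1
  funext n
  rw [ballotSeries, PowerSeries.coeff_mk, coeff_triangularSeries, Finset.sum_div]
  refine Finset.sum_congr rfl fun k _ => ?_
  split_ifs
  · rw [scaledBallot, mul_div_assoc]
  · rw [zero_div]

end RegularFamily

/-! ### Extracting the coefficient of `x ^ m` -/

section CoefficientRatio

/-- The ratio of the coefficients of `x ^ (m - t)` and `x ^ m` in `(1 - x) ^ (-(K + 1))`. -/
noncomputable def coeffRatio (K m t : ℕ) : ℝ :=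
  if t ≤ m then ((K + (m - t)).choose K : ℝ) / (K + m).choose K else 0

theorem coeffRatio_zero (K m : ℕ) : coeffRatio K m 0 = 1 := by
  rw [coeffRatio, if_pos (Nat.zero_le _), Nat.sub_zero, div_self]
  exact_mod_cast (Nat.choose_pos (Nat.le_add_right K m)).ne'

theorem coeffRatio_nonneg (K m t : ℕ) : 0 ≤ coeffRatio K m t := by
  unfold coeffRatio; split_ifs <;> positivity

theorem coeffRatio_succ (K m t : ℕ) :
    coeffRatio K m (t + 1) = coeffRatio K m t * (((m : ℝ) - t) / (K + m - t)) := by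
  rcases lt_trichotomy t m with h | rfl | h
  · obtain ⟨s, rfl⟩ := Nat.exists_eq_add_of_lt h
    rw [coeffRatio, coeffRatio, if_pos (by omega), if_pos (by omega),
      show t + s + 1 - (t + 1) = s by omega, show t + s + 1 - t = s + 1 by omega]
    have h1 : ((K + s).choose K : ℝ) * (K + s + 1) = (K + (s + 1)).choose K * (s + 1) := by
      have := Nat.choose_mul_succ_eq (K + s) K
      rw [show K + s + 1 - K = s + 1 by omega] at this
      exact_mod_cast this
    have h2 : (K : ℝ) + s + 1 ≠ 0 := by positivity
    push_cast
    rw [show (t : ℝ) + s + 1 - t = s + 1 by ring,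
      show (K : ℝ) + (t + s + 1) - t = K + s + 1 by ring, div_mul_div_comm, ← h1,
      mul_div_mul_right _ _ h2]
  · simp [coeffRatio]
  · simp [coeffRatio, Nat.not_le.2 h, Nat.not_le.2 (h.trans (Nat.lt_succ_self t))]

/-- The ratio is a product of factors `(m - j) / (K + m - j)`, which decrease in `j` from `m / (K +
m)`. -/
theorem coeffRatio_le_pow {K m : ℕ} {r : ℝ} (hr : (m : ℝ) / (K + m) ≤ r) (t : ℕ) :
    coeffRatio K m t ≤ r ^ t := by
  have hr0 : 0 ≤ r := le_trans (by positivity) hr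
  induction t with
  | zero => rw [coeffRatio_zero, pow_zero]
  | succ t ih =>
    rcases lt_or_ge t m with h | h
    · rw [coeffRatio_succ, pow_succ]
      have h1 : (t : ℝ) < m := by exact_mod_cast h
      have h2 : (0 : ℝ) ≤ K := Nat.cast_nonneg K
      have h3 : (0 : ℝ) ≤ t := Nat.cast_nonneg t
      refine mul_le_mul ih (le_trans ?_ hr) (div_nonneg (by linarith) (by linarith)) (by positivity)
      rw [div_le_div_iff₀ (by linarith) (by linarith)]
      nlinarith
    · rw [coeffRatio, if_neg (by omega)]
      positivity

theorem coeffRatio_le_one (K m t : ℕ) : coeffRatio K m t ≤ 1 := by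
  simpa using coeffRatio_le_pow (K := K) (m := m) (r := 1)
    (div_le_one_of_le₀ (le_add_of_nonneg_left (Nat.cast_nonneg K)) (by positivity)) t

theorem crossingRatio_nonneg (n m : ℕ) : 0 ≤ crossingRatio n m := by
  unfold crossingRatio; positivity

theorem crossingRatio_le_one (n m : ℕ) : crossingRatio n m ≤ 1 :=
  div_le_one_of_le₀ (le_add_of_nonneg_right (Nat.cast_nonneg n)) (by positivity)

/-- The difference is at most `(t + 1) / (n - 1 - t)`, whatever the growth of `m`. -/
theorem tendsto_ratio_sub_crossingRatio (m : ℕ → ℕ) (t : ℕ) :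
    Tendsto (fun n => ((m n : ℝ) - t) / (((n - 1 : ℕ) : ℝ) + m n - t) - crossingRatio n (m n))
      atTop (nhds 0) := by
  have h0 : Tendsto (fun n : ℕ => ((t : ℝ) + 1) / ((n : ℝ) + (-1 - t))) atTop (nhds 0) :=
    tendsto_const_nhds.div_atTop (tendsto_atTop_add_const_right _ _ tendsto_natCast_atTop_atTop)
  refine squeeze_zero_norm' ?_ h0
  filter_upwards [eventually_ge_atTop (t + 2)] with n hn
  have hn1 : ((t : ℝ) + 2) ≤ n := by exact_mod_cast hn
  have ht : (0 : ℝ) ≤ t := Nat.cast_nonneg t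
  have hm : (0 : ℝ) ≤ m n := Nat.cast_nonneg _
  have hp1 : (0 : ℝ) < n - 1 + m n - t := by linarith
  have hp2 : (0 : ℝ) < m n + n := by linarith
  have hp3 : (0 : ℝ) < n + (-1 - t) := by linarith
  rw [Nat.cast_sub (by omega), Nat.cast_one, crossingRatio, div_sub_div _ _ hp1.ne' hp2.ne',
    norm_div, Real.norm_of_nonneg (mul_pos hp1 hp2).le, Real.norm_eq_abs,
    div_le_div_iff₀ (mul_pos hp1 hp2) hp3,
    show ((m n : ℝ) - t) * (m n + n) - (n - 1 + m n - t) * m n = m n - t * n by ring]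
  have h1 : |(m n : ℝ) - t * n| ≤ (t + 1) * (m n + n) := by
    rw [abs_le]; constructor <;> nlinarith
  calc |(m n : ℝ) - t * n| * (n + (-1 - t)) ≤ (t + 1) * (m n + n) * (n - 1 + m n - t) :=
        mul_le_mul h1 (by linarith) hp3.le (by positivity)
    _ = _ := by ring

theorem tendsto_coeffRatio_sub_pow (m : ℕ → ℕ) (t : ℕ) :
    Tendsto (fun n => coeffRatio (n - 1) (m n) t - crossingRatio n (m n) ^ t) atTop (nhds 0) := by
  induction t with
  | zero => simp [coeffRatio_zero]
  | succ t ih =>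
    have h1 : Tendsto (fun n => coeffRatio (n - 1) (m n) t * (((m n : ℝ) - t) /
        (((n - 1 : ℕ) : ℝ) + m n - t) - crossingRatio n (m n))) atTop (nhds 0) := by
      refine squeeze_zero_norm (fun n => ?_)
        (tendsto_zero_iff_norm_tendsto_zero.1 (tendsto_ratio_sub_crossingRatio m t))
      rw [norm_mul]
      refine mul_le_of_le_one_left (norm_nonneg _) ?_
      rw [Real.norm_of_nonneg (coeffRatio_nonneg _ _ _)]
      exact coeffRatio_le_one _ _ _
    have h2 : Tendsto (fun n => crossingRatio n (m n) * (coeffRatio (n - 1) (m n) t -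
        crossingRatio n (m n) ^ t)) atTop (nhds 0) := by
      refine squeeze_zero_norm (fun n => ?_) (tendsto_zero_iff_norm_tendsto_zero.1 ih)
      rw [norm_mul]
      refine mul_le_of_le_one_left (norm_nonneg _) ?_
      rw [Real.norm_of_nonneg (crossingRatio_nonneg _ _)]
      exact crossingRatio_le_one _ _
    have h3 := h1.add h2
    rw [add_zero] at h3
    refine h3.congr fun n => ?_
    rw [coeffRatio_succ]
    ring

theorem chordSeriesPowCoeff_eq (l m : ℕ) {n : ℕ} (hn : 1 ≤ n) :
    chordSeriesPowCoeff l n m = ((n + m - 1).choose (n - 1) : ℝ) *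
      ∑' t, PowerSeries.coeff t (PowerSeries.coeff n (ballotSeries ^ l)) *
        coeffRatio (n - 1) m t := by
  obtain ⟨K, rfl⟩ := Nat.exists_eq_add_of_le' hn
  have h1 : (1 - PowerSeries.X) ^ (K + 1) * PowerSeries.coeff (K + 1) (chordSeries ^ l) =
      PowerSeries.coeff (K + 1) (ballotSeries ^ l) := by
    rw [← PowerSeries.coeff_rescale, map_pow, rescale_chordSeries]
  have h2 := PowerSeries.mk_add_choose_mul_one_sub_pow_eq_one ℝ K
  have h3 : PowerSeries.coeff (K + 1) (chordSeries ^ l) =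
      PowerSeries.coeff (K + 1) (ballotSeries ^ l) *
        PowerSeries.mk fun n => ((K + n).choose K : ℝ) := by
    rw [← h1, mul_comm, ← mul_assoc, h2, one_mul]
  have hpos : ((K + m).choose K : ℝ) ≠ 0 := by
    exact_mod_cast (Nat.choose_pos (Nat.le_add_right K m)).ne'
  rw [chordSeriesPowCoeff, h3, PowerSeries.coeff_mul, tsum_eq_sum (s := Finset.range (m + 1)),
    Finset.mul_sum, Finset.Nat.sum_antidiagonal_eq_sum_range_succ_mk]
  · refine Finset.sum_congr rfl fun t ht => ?_
    rw [PowerSeries.coeff_mk, coeffRatio, if_pos (Nat.lt_succ_iff.1 (Finset.mem_range.1 ht)),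
      Nat.add_sub_cancel, show K + 1 + m - 1 = K + m by omega]
    field_simp
  · intro t ht
    rw [Finset.mem_range] at ht
    rw [coeffRatio, if_neg (by omega), mul_zero]

theorem chordSeriesPowCoeff_one (n m : ℕ) : chordSeriesPowCoeff 1 n m = chordCount n m := by
  rw [chordSeriesPowCoeff, pow_one, chordSeries, PowerSeries.coeff_mk, PowerSeries.coeff_mk]

end CoefficientRatio

/-! ### Passage to the limit and uniform lower bounds -/

section Asymptotics

theorem isEquivalent_of_eventually_mul {u v N S E : ℕ → ℝ} {c : ℝ} (hc : 0 < c)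
    (hu : ∀ᶠ n in atTop, u n = N n * S n) (hv : ∀ᶠ n in atTop, v n = N n * E n)
    (hE : ∀ᶠ n in atTop, c ≤ E n) (hS : Tendsto (fun n => S n - E n) atTop (nhds 0)) :
    u ~[atTop] v := by
  have h1 : (fun n => S n - E n) =o[atTop] E :=
    ((isLittleO_one_iff ℝ).2 hS).trans_isBigO (IsBigO.of_bound c⁻¹ (by
      filter_upwards [hE] with n hn
      rw [norm_one, Real.norm_of_nonneg (hc.le.trans hn), inv_mul_eq_div, one_le_div hc]
      exact hn))
  have h2 := (isBigO_refl N atTop).mul_isLittleO h1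
  refine h2.congr' ?_ ?_
  · filter_upwards [hu, hv] with n h3 h4
    rw [Pi.sub_apply, h3, h4, mul_sub]
  · filter_upwards [hv] with n h4
    exact h4.symm

variable {m : ℕ → ℕ}

theorem exists_eventually_ratio_le
    (hm : (fun n : ℕ => (m n : ℝ)) =O[atTop] (fun n : ℕ => (n : ℝ))) :
    ∃ r : ℝ, 0 ≤ r ∧ r < 1 ∧ ∀ᶠ n in atTop, (m n : ℝ) / ((n - 1 : ℕ) + m n) ≤ r := by
  obtain ⟨c, hc, h⟩ := hm.exists_pos
  -- For `n ≥ 2`, `m ≤ c n ≤ 2 c (n - 1)`; the factor `2` absorbs the `n - 1` in the denominator.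
  refine ⟨2 * c / (1 + 2 * c), by positivity, by rw [div_lt_one (by positivity)]; linarith, ?_⟩
  filter_upwards [h.bound, eventually_ge_atTop 2] with n hn hn2
  rw [Real.norm_natCast, Real.norm_natCast] at hn
  have h2 : (2 : ℝ) ≤ n := by exact_mod_cast hn2
  have hm0 : (0 : ℝ) ≤ m n := Nat.cast_nonneg _
  rw [Nat.cast_sub (by omega), Nat.cast_one, div_le_div_iff₀ (by linarith) (by positivity)]
  nlinarith

theorem crossingRatio_le {n k : ℕ} (hn : 2 ≤ n) {r : ℝ}
    (h : (k : ℝ) / ((n - 1 : ℕ) + k) ≤ r) : crossingRatio n k ≤ r := by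
  refine le_trans ?_ h
  have h1 : (0 : ℝ) < ((n - 1 : ℕ) : ℝ) := by exact_mod_cast (by omega : 0 < n - 1)
  have h2 : ((n - 1 : ℕ) : ℝ) ≤ n := by exact_mod_cast Nat.sub_le n 1
  rw [crossingRatio, add_comm (k : ℝ)]
  gcongr

theorem one_sub_le_altTriangularSeries {q : ℝ} (h0 : 0 ≤ q) (h1 : q < 1) :
    1 - q ≤ altTriangularSeries q := by
  have hs : Summable fun j : ℕ => (-1 : ℝ) ^ j * q ^ (j + 1).choose 2 := by
    refine Summable.of_norm_bounded (summable_geometric_of_lt_one h0 h1) fun j => ?_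
    rw [norm_mul, norm_pow, norm_neg, norm_one, one_pow, one_mul,
      Real.norm_of_nonneg (pow_nonneg h0 _)]
    exact pow_succ_choose_two_le h0 h1 j
  have ha : Antitone fun j : ℕ => q ^ (j + 1).choose 2 := fun i j hij =>
    pow_le_pow_of_le_one h0 h1.le (strictMono_succ_choose_two.monotone hij)
  -- The partial sum with two terms, `1 - q`, is a lower bound for the alternating series.
  have h := ha.alternating_series_le_tendsto hs.hasSum.tendsto_sum_nat 1
  simpa [Finset.sum_range_succ, altTriangularSeries, ← sub_eq_add_neg] using h

/-- The value `q` depends on `n` and need not converge, so the moving target is subtracted inside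
the sum and dominated convergence is applied to the differences. -/
theorem tendsto_tsum_coeffRatio_sub {A : PowerSeries (PowerSeries ℝ)} {α S D : PowerSeries ℝ}
    (hA : RegularFamily A α S D) (hD : DiskSummable D) {r : ℝ} (h0 : 0 ≤ r) (h1 : r < 1)
    (hr : ∀ᶠ n in atTop, (m n : ℝ) / ((n - 1 : ℕ) + m n) ≤ r) :
    Tendsto (fun n => (∑' t, PowerSeries.coeff t (PowerSeries.coeff n A) / catalan n *
      coeffRatio (n - 1) (m n) t) - seriesEval (crossingRatio n (m n)) α) atTop (nhds 0) := by
  have hdiv : ∀ n t, PowerSeries.coeff t (PowerSeries.coeff n A) / catalan n =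
      PowerSeries.coeff t (PowerSeries.coeff n A) / 4 ^ n / scaledCatalan n := fun n t => by
    rw [scaledCatalan, div_div_div_cancel_right₀ (by positivity)]
  have hbA : ∀ n t, |PowerSeries.coeff t (PowerSeries.coeff n A) / catalan n| ≤
      PowerSeries.coeff t D := fun n t => by
    rw [hdiv, abs_div, abs_of_pos (scaledCatalan_pos n), div_le_iff₀ (scaledCatalan_pos n)]
    exact (hA t).bound n
  have hD0 : ∀ t, 0 ≤ PowerSeries.coeff t D := fun t => (hA t).const_nonneg
  have hsD : Summable fun t => PowerSeries.coeff t D * r ^ t := (hD r h0 h1).of_norm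
  have key : Tendsto (fun n => ∑' t, (PowerSeries.coeff t (PowerSeries.coeff n A) / catalan n *
      coeffRatio (n - 1) (m n) t - PowerSeries.coeff t α * crossingRatio n (m n) ^ t))
      atTop (nhds (∑' _ : ℕ, (0 : ℝ))) := by
    refine tendsto_tsum_of_dominated_convergence
      (bound := fun t => PowerSeries.coeff t D * r ^ t + PowerSeries.coeff t D * r ^ t)
      (hsD.add hsD) (fun t => ?_) ?_
    · have e1 : Tendsto (fun n => (PowerSeries.coeff t (PowerSeries.coeff n A) / catalan n -
          PowerSeries.coeff t α) * coeffRatio (n - 1) (m n) t) atTop (nhds 0) := by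
        have e2 : Tendsto (fun n => PowerSeries.coeff t (PowerSeries.coeff n A) / catalan n -
            PowerSeries.coeff t α) atTop (nhds 0) := by
          simp only [hdiv]
          simpa using (hA t).lim.sub_const (PowerSeries.coeff t α)
        refine squeeze_zero_norm (fun n => ?_) (tendsto_zero_iff_norm_tendsto_zero.1 e2)
        rw [norm_mul]
        refine mul_le_of_le_one_right (norm_nonneg _) ?_
        rw [Real.norm_of_nonneg (coeffRatio_nonneg _ _ _)]
        exact coeffRatio_le_one _ _ _
      have e3 := e1.add ((tendsto_coeffRatio_sub_pow m t).const_mul (PowerSeries.coeff t α))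
      rw [mul_zero, add_zero] at e3
      refine e3.congr fun n => ?_
      ring
    · filter_upwards [hr, eventually_ge_atTop 2] with n hn hn2 t
      refine (norm_sub_le _ _).trans (add_le_add ?_ ?_)
      · rw [norm_mul, Real.norm_of_nonneg (coeffRatio_nonneg _ _ _), Real.norm_eq_abs]
        exact mul_le_mul (hbA n t) (coeffRatio_le_pow hn t) (coeffRatio_nonneg _ _ _) (hD0 t)
      · have hq := crossingRatio_nonneg n (m n)
        rw [norm_mul, Real.norm_of_nonneg (pow_nonneg hq t), Real.norm_eq_abs]
        exact mul_le_mul (hA t).abs_lim_le (pow_le_pow_left₀ hq (crossingRatio_le hn2 hn) t)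
          (pow_nonneg hq t) (hD0 t)
  rw [tsum_zero] at key
  refine key.congr' ?_
  filter_upwards [hr, eventually_ge_atTop 2] with n hn hn2
  have hq := crossingRatio_nonneg n (m n)
  rw [seriesEval, Summable.tsum_sub]
  · refine Summable.of_norm_bounded hsD fun t => ?_
    rw [norm_mul, Real.norm_of_nonneg (coeffRatio_nonneg _ _ _), Real.norm_eq_abs]
    exact mul_le_mul (hbA n t) (coeffRatio_le_pow hn t) (coeffRatio_nonneg _ _ _) (hD0 t)
  · refine Summable.of_norm_bounded hsD fun t => ?_
    rw [norm_mul, Real.norm_of_nonneg (pow_nonneg hq t), Real.norm_eq_abs]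
    exact mul_le_mul (hA t).abs_lim_le (pow_le_pow_left₀ hq (crossingRatio_le hn2 hn) t)
      (pow_nonneg hq t) (hD0 t)

theorem seriesEval_powLimit {q : ℝ} (h0 : 0 ≤ q) (h1 : q < 1) (l : ℕ) :
    seriesEval q (PowerSeries.C ((l : ℝ) + 1) * ((triangularSeries fun k => (-1) ^ k * (2 * k + 1)) *
      (triangularSeries fun k => 2 * (-1) ^ k) ^ l)) =
    ((l : ℝ) + 1) * (2 * altTriangularSeries q) ^ l * eulerProductCubed q := by
  have hα : DiskSummable (triangularSeries fun k => (-1) ^ k * (2 * k + 1)) :=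
    diskSummable_triangularSeries (b := 1) fun k => by
      rw [abs_mul, abs_pow, abs_neg, abs_one, one_pow]
      exact mul_le_mul_of_nonneg_left (abs_of_nonneg (by positivity)).le zero_le_one
  have hS : DiskSummable (triangularSeries fun k => 2 * (-1) ^ k) :=
    diskSummable_triangularSeries (b := 2) fun k => by
      rw [abs_mul, abs_pow, abs_neg, abs_one, one_pow, abs_two]
      have : (0 : ℝ) ≤ k := Nat.cast_nonneg k
      linarith
  rw [seriesEval_mul (diskSummable_C _) (hα.mul (hS.pow l)) h0 h1, seriesEval_C,
    seriesEval_mul hα (hS.pow l) h0 h1, seriesEval_pow hS h0 h1, seriesEval_triangularSeries,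
    seriesEval_triangularSeries, (hasSum_jacobi h0 h1).tsum_eq, ← eulerProductCubed_eq h0 h1]
  simp only [mul_assoc]
  rw [tsum_mul_left, ← altTriangularSeries]
  ring

theorem chordSeriesPowCoeff_isEquivalent
    (hm : (fun n : ℕ => (m n : ℝ)) =O[atTop] (fun n : ℕ => (n : ℝ))) (l : ℕ) :
    (fun n : ℕ => chordSeriesPowCoeff (l + 1) n (m n)) ~[atTop]
      (fun n : ℕ => ((l : ℝ) + 1) * (2 * altTriangularSeries (crossingRatio n (m n))) ^ l *
        (((n + m n - 1).choose (n - 1) : ℝ) * (catalan n : ℝ) *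
          eulerProductCubed (crossingRatio n (m n)))) := by
  obtain ⟨r, h0, h1, hr⟩ := exists_eventually_ratio_le hm
  obtain ⟨D, hD, hA⟩ := regularFamily_ballotSeries.pow
    (diskSummable_triangularSeries (b := 1) fun k => by
      rw [one_mul, abs_of_nonneg (by positivity)]) l
  have hlim := tendsto_tsum_coeffRatio_sub hA hD h0 h1 hr
  have hP := eulerProduct_pos h0 h1
  have hr1 : 0 < 1 - r := sub_pos.2 h1
  -- Lower bound at `q ≤ r`: `1 - r ≤ 1 - q ≤ f(q)`, the Euler product is antitone, and the factor
  -- `l + 1 ≥ 1` is dropped.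
  refine isEquivalent_of_eventually_mul (c := (2 * (1 - r)) ^ l * eulerProduct r ^ 3)
    (by positivity) (N := fun n => ((n + m n - 1).choose (n - 1) : ℝ) * (catalan n : ℝ))
    ?_ ?_ ?_ hlim
  · filter_upwards [eventually_ge_atTop 1] with n hn
    have hc : (catalan n : ℝ) ≠ 0 := by exact_mod_cast (catalan_pos n).ne'
    rw [chordSeriesPowCoeff_eq _ _ hn, mul_assoc, ← tsum_mul_left (a := (catalan n : ℝ))]
    congr 2
    funext t
    field_simp
  · filter_upwards [hr, eventually_ge_atTop 2] with n hn hn2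
    rw [seriesEval_powLimit (crossingRatio_nonneg _ _) ((crossingRatio_le hn2 hn).trans_lt h1)]
    ring
  · filter_upwards [hr, eventually_ge_atTop 2] with n hn hn2
    have hq0 := crossingRatio_nonneg n (m n)
    have hqr := crossingRatio_le hn2 hn
    have hq1 := hqr.trans_lt h1
    rw [seriesEval_powLimit hq0 hq1, eulerProductCubed_eq hq0 hq1]
    have hf := one_sub_le_altTriangularSeries hq0 hq1
    have hl : (0 : ℝ) ≤ l := Nat.cast_nonneg l
    have h2 : (2 * (1 - r)) ^ l ≤ (2 * altTriangularSeries (crossingRatio n (m n))) ^ l :=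
      pow_le_pow_left₀ (by positivity) (by linarith) l
    refine mul_le_mul (h2.trans (le_mul_of_one_le_left ?_ (by linarith)))
      (pow_le_pow_left₀ hP.le (eulerProduct_antitone hq0 hqr h1) 3) (by positivity) ?_
    · exact (pow_nonneg (by positivity) l).trans h2
    · exact mul_nonneg (by positivity) ((pow_nonneg (by positivity) l).trans h2)

end Asymptotics

theorem mainTheorem5 (m : ℕ → ℕ)
    (hm : (fun n : ℕ => (m n : ℝ)) =O[atTop] (fun n : ℕ => (n : ℝ))) :
    ((fun n : ℕ => (chordCount n (m n) : ℝ)) ~[atTop]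
      (fun n : ℕ => ((n + m n - 1).choose (n - 1) : ℝ) * (catalan n : ℝ) *
        eulerProductCubed (crossingRatio n (m n)))) ∧
    (∀ l : ℕ, 1 ≤ l →
      (fun n : ℕ => chordSeriesPowCoeff l n (m n)) ~[atTop]
        (fun n : ℕ => (l : ℝ) * (2 * altTriangularSeries (crossingRatio n (m n))) ^ (l - 1) *
          (chordCount n (m n) : ℝ))) := by
  have h1 : (fun n : ℕ => (chordCount n (m n) : ℝ)) ~[atTop]
      (fun n : ℕ => ((n + m n - 1).choose (n - 1) : ℝ) * (catalan n : ℝ) *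
        eulerProductCubed (crossingRatio n (m n))) := by
    simpa [chordSeriesPowCoeff_one] using chordSeriesPowCoeff_isEquivalent hm 0
  refine ⟨h1, fun l hl => ?_⟩
  obtain ⟨l, rfl⟩ := Nat.exists_eq_add_of_le' hl
  refine (chordSeriesPowCoeff_isEquivalent hm l).trans ?_
  simp only [Nat.cast_add, Nat.cast_one, Nat.add_sub_cancel]
  exact IsEquivalent.refl.mul h1.symm
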